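/- Let $N$ and $\Pi$ be non-decreasing right-continuous functions on $\mathbb{R}$, supported in $[1,\infty)$, with $N(1)=1$, $\Pi(1)=0$ and $\mathrm{d}N=\exp^{*}(\mathrm{d}\Pi)=\sum_{n\ge 0}(\mathrm{d}\Pi)^{*n}/n!$, where $*$ is the multiplicative convolution of measures (a Beurling generalized number system). Let $g$ be a complex-valued function that is $\mathrm{d}\Pi$-integrable on $[1,X]$ for every $X$. Let $\mathrm{d}G=\exp^{*}(g\,\mathrm{d}\Pi)=\sum_{n\ge 0}(g\,\mathrm{d}\Pi)^{*n}/n!$, $G(x)=\int_{1^-}^{x}\mathrm{d}G(u)$ and $\widehat G(s)=\int_{1^-}^{\infty}u^{-s}\,\mathrm{d}G(u)=\lim_{X\to\infty}\int_{1^-}^{X}u^{-s}\,\mathrm{d}G(u)$. Suppose that $\int_1^x u^{-1}\,\mathrm{d}\Pi(u)\le\log\log x+O(1)$ and $\int_1^x|g(u)|\log u\,\mathrm{d}\Pi(u)\ll x$; explicitly, let $K$ be a constant with $$\int_1^x\frac{\mathrm{d}\Pi(u)}{u}\le\log\log x+K\quad(x\ge 2),\qquad \int_1^x|g(u)|\log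 u\,\mathrm{d}\Pi(u)\le Kx\quad(x\ge 1).$$ Then the limit defining $\widehat G(s)$ exists for $\Re s>1$, $\widehat G$ is differentiable and has no zeros there, and the following bounds hold with implied constants that depend only on $K$. For all $x\ge 1$, $$\frac{|G(x)|}{x}\ll\exp\left(\int_1^x\frac{|g(u)|-1}{u}\,\mathrm{d}\Pi(u)\right),$$ and for all $\sigma>1$ (in particular as $\sigma\to1^+$), $$\int_{\Re s=\sigma}\left|\frac{\widehat G(s)}{s}\right|^2|\mathrm{d}s|\ll\int_0^\infty e^{-2y(\sigma-1)}\exp\left(2\int_1^{e^y}\frac{|g(u)|-1}{u}\,\mathrm{d}\Pi(u)\right)\mathrm{d}y,$$ $$\int_{\Re s=\sigma}\left|\frac{\widehat G'(s)}{s\,\widehat G(s)}\right|^2|\mathrm{d}s|\ll\frac1{\sigma-1},$$ where all the integrals are finite. -/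

import Mathlib

open MeasureTheory Set

noncomputable section

/-- Finite tuples `(u₁, …, uₙ)` of real numbers, of arbitrary length `n ≥ 0`. -/
abbrev Tuples : Type := Σ n : ℕ, Fin n → ℝ

/-- The product `u₁ ⋯ uₙ` of the entries of a tuple (`1` for the empty tuple). -/
def tupleProd (c : Tuples) : ℝ := ∏ i, c.2 i

/-- The measure `∑ₙ μ^{⊗ n} / n!` on tuples (`μ^{⊗ 0}` is the unit mass at the empty tuple). -/
def tupleMeasure (μ : Measure ℝ) : Measure Tuples :=
  Measure.sum fun n : ℕ =>
    ((n.factorial : ENNReal)⁻¹) • (Measure.pi fun _ : Fin n => μ).map (Sigma.mk n)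

/-- The exponential `exp^*(μ) = ∑ₙ μ^{* n} / n!` of a positive measure with respect to
multiplicative convolution. The convolution power `μ^{* n}` is the image of `μ^{⊗ n}` under
`(u₁, …, uₙ) ↦ u₁ ⋯ uₙ`; in particular `μ^{* 0}` is the unit mass at `1`. -/
def convExp (μ : Measure ℝ) : Measure ℝ := (tupleMeasure μ).map tupleProd

/-- The restriction to `[1, X]` of the exponential `exp^*(g μ) = ∑ₙ (g μ)^{* n} / n!` of the complex
measure `g μ`. Here `(g μ)^{* n}` is the image of `(g μ)^{⊗ n} = g(u₁) ⋯ g(uₙ) μ^{⊗ n}` under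
`(u₁, …, uₙ) ↦ u₁ ⋯ uₙ`. The exponential is only locally finite, so that it is given by its
restrictions to the intervals `[1, X]`, which are complex measures. -/
def convExpDensity (μ : Measure ℝ) (g : ℝ → ℂ) (X : ℝ) : ComplexMeasure ℝ :=
  (((tupleMeasure μ).restrict {c | tupleProd c ∈ Icc 1 X}).withDensityᵥ
    fun c => ∏ i, g (c.2 i)).map tupleProd

/-- A Beurling generalized number system in the broad sense (not necessarily discrete): two
non-decreasing right-continuous functions `N` (generalized integers) and `Π` (generalized prime
powers) with support in `[1, ∞)`, `N(1) = 1`, `Π(1) = 0` and `dN = exp^*(dΠ)`. -/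
structure BeurlingSystem where
  /-- The counting function `N` of the generalized integers. -/
  intCount : StieltjesFunction ℝ
  /-- The weighted counting function `Π` of the generalized prime powers. -/
  primeCount : StieltjesFunction ℝ
  intCount_of_lt_one : ∀ x < 1, intCount x = 0
  primeCount_of_lt_one : ∀ x < 1, primeCount x = 0
  intCount_one : intCount 1 = 1
  primeCount_one : primeCount 1 = 0
  intCount_measure : intCount.measure = convExp primeCount.measure

namespace BeurlingSystem

variable (S : BeurlingSystem) (g : ℝ → ℂ)

/-- The measure `dΠ`. -/
def dPi : Measure ℝ := S.primeCount.measure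

/-- The restriction to `[1, X]` of the multiplicative measure `dG = exp^*(g dΠ)`. -/
def dG (X : ℝ) : ComplexMeasure ℝ := convExpDensity S.dPi g X

/-- The summatory function `G(x) = ∫_{1⁻}^x dG`. -/
def summatory (x : ℝ) : ℂ := S.dG g x (Icc 1 x)

/-- The truncated Mellin-Stieltjes transform `∫_{1⁻}^X u^{-s} dG(u)`. -/
def mellinTrunc (s : ℂ) (X : ℝ) : ℂ :=
  (S.dG g X).integral (fun u => (u : ℂ) ^ (-s)) (ContinuousLinearMap.mul ℝ ℂ)

/-- The Mellin-Stieltjes transform `Ĝ(s) = ∫_{1⁻}^∞ u^{-s} dG(u)`, the limit of the truncated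
transforms. -/
def mellinHat (s : ℂ) : ℂ := Filter.limUnder Filter.atTop (S.mellinTrunc g s)

end BeurlingSystem

end

/-! Write μ for dΠ. Everything is computed on the space of finite tuples with the measure ∑
μ^{⊗n}/n!, where the integral of ∏ f(uᵢ) is exp(∫ f dμ). Taking f(u) = g(u) u⁻ˢ gives the Euler
product Ĝ(s) = exp(∫ g(u) u⁻ˢ dμ) for Re s > 1 (`integral_prod_mul_cpow`), hence convergence,
non-vanishing and Ĝ'/Ĝ = -∫ g(u) (log u) u⁻ˢ dμ.

For the pointwise bound, let dF be the exponential of |g| dμ, so that |G| ≤ F. From log · dF = dF *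
(|g| log · dμ) and the Chebyshev-type hypothesis, ∫_{u ≤ x} log u dF ≤ K x ∫_{u ≤ x} dF/u, and the
last integral is at most exp(∫_1^x |g|/u dμ). Since log x ≤ log u + x/u, F(x) max(1, log x) is at
most (K + 1) x times this exponential (`setLIntegral_prod_mul_log_le`). The Mertens-type hypothesis
bounds 1/max(1, log x) by e^K exp(-∫_1^x u⁻¹ dμ), which replaces |g| by |g| - 1 in the exponent.

For the mean squares, Ĝ(s)/s is the Laplace transform of G(e^y), so on Re s = σ it is the Fourier
transform of G(e^y) e^{-σy}. Plancherel (`integral_norm_sq_mellin_div`) and the pointwise bound give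
the first estimate. The second is the same argument for the summatory function of -g log u dμ, which
is at most K e^y in absolute value. -/

/-! ### Plancherel's formula for functions in L¹ ∩ L². -/

section Plancherel

open scoped FourierTransform

/-- The `L²` Fourier transform of an integrable square-integrable function is given by the
Fourier integral. -/
theorem fourier_toLp_ae_eq {f : ℝ → ℂ} (h1 : Integrable f) (h2 : MemLp f 2) :
    (𝓕 (h2.toLp f) : Lp ℂ 2 (volume : Measure ℝ)) =ᵐ[volume] 𝓕 f := by
  have hcont : Continuous (𝓕 f) :=
    VectorFourier.fourierIntegral_continuous Real.continuous_fourierChar (by fun_prop) h1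
  -- Both sides are tested against smooth compactly supported φ. The L² transform, as a tempered
  -- distribution, moves the Fourier transform onto φ, and so does the multiplication formula for
  -- the Fourier integral.
  refine ae_eq_of_integral_contDiff_smul_eq ((Lp.memLp _).locallyIntegrable (by norm_num))
    hcont.locallyIntegrable fun φ hφ hφc => ?_
  have hc : HasCompactSupport (fun x => (φ x : ℂ)) := hφc.comp_left (g := Complex.ofReal) rfl
  have hd : ContDiff ℝ ((⊤ : ℕ∞) : WithTop ℕ∞) (fun x => (φ x : ℂ)) :=
    Complex.ofRealCLM.contDiff.comp hφ
  set Φ : SchwartzMap ℝ ℂ := hc.toSchwartzMap hd with hΦ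
  have hΦv : ∀ x, Φ x = (φ x : ℂ) := fun x => rfl
  have e := congrArg (fun T : TemperedDistribution ℝ ℂ => T Φ)
    (Lp.fourier_toTemperedDistribution_eq (h2.toLp f))
  simp only [TemperedDistribution.fourier_apply, Lp.toTemperedDistribution_apply, hΦv] at e
  have e2 : ∫ x, (𝓕 Φ) x • (h2.toLp f) x = ∫ x, (φ x : ℂ) • 𝓕 f x := by
    have := VectorFourier.integral_fourierIntegral_smul_eq_flip (L := innerₗ ℝ)
      (μ := (volume : Measure ℝ)) (ν := (volume : Measure ℝ))
      Real.continuous_fourierChar (by fun_prop) Φ.integrable h1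
    refine (integral_congr_ae (g := fun x => (𝓕 Φ) x • f x)
      ((h2.coeFn_toLp).mono fun x hx => by simp only [hx])).trans ?_
    simpa [SchwartzMap.fourier_coe, flip_innerₗ] using! this
  rw [e2] at e
  simpa [Complex.real_smul] using e.symm

theorem integral_norm_sq_fourier {f : ℝ → ℂ} (h1 : Integrable f) (h2 : MemLp f 2) :
    Integrable (fun t => ‖𝓕 f t‖ ^ 2) ∧ ∫ t, ‖𝓕 f t‖ ^ 2 = ∫ x, ‖f x‖ ^ 2 := by
  have hm : MemLp (𝓕 f) 2 := (memLp_congr_ae (fourier_toLp_ae_eq h1 h2)).1 (Lp.memLp _)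
  refine ⟨hm.integrable_norm_pow (by norm_num), ?_⟩
  have key : ∀ F : Lp ℂ 2 (volume : Measure ℝ), ∫ x, ‖F x‖ ^ 2 = ‖F‖ ^ 2 := fun F => by
    have := inner_self_eq_norm_sq_to_K (𝕜 := ℂ) F
    rw [L2.inner_def] at this
    simp only [inner_self_eq_norm_sq_to_K] at this
    have h : ((∫ x, ‖F x‖ ^ 2 : ℝ) : ℂ) = ((‖F‖ ^ 2 : ℝ) : ℂ) := by
      rw [← integral_complex_ofReal]; simpa using this
    exact_mod_cast h
  calc ∫ t, ‖𝓕 f t‖ ^ 2 = ∫ t, ‖(𝓕 (h2.toLp f) : Lp ℂ 2 (volume : Measure ℝ)) t‖ ^ 2 :=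
        integral_congr_ae ((fourier_toLp_ae_eq h1 h2).mono fun x hx => by simp only [hx])
    _ = ∫ t, ‖(h2.toLp f) t‖ ^ 2 := by rw [key, key, Lp.norm_fourier_eq]
    _ = _ := integral_congr_ae ((h2.coeFn_toLp).mono fun x hx => by simp only [hx])

end Plancherel

/-! ### Mellin transforms of summatory functions. -/

section Mellin

variable {α : Type*} [MeasurableSpace α] {ν : Measure α} {h : α → ℂ} {p : α → ℝ}

theorem integrableOn_indicator_mul_exp {q : ℝ} {s : ℂ} (hs : 0 < s.re) :
    IntegrableOn (fun y : ℝ => {y : ℝ | q ≤ Real.exp y}.indicator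
      (fun y : ℝ => Complex.exp (-s * y)) y) (Ioi 0) := by
  refine (integrableOn_exp_mul_complex_Ioi (a := -s) (by simpa) 0).indicator ?_
  exact measurableSet_le measurable_const (by fun_prop)

theorem setOf_le_exp_inter_Ioi_ae_eq {q : ℝ} (hq : 1 ≤ q) :
    ({y : ℝ | q ≤ Real.exp y} ∩ Ioi 0 : Set ℝ) =ᵐ[volume] Ioi (Real.log q) := by
  have h0 : 0 < q := by linarith
  have h1 : 0 ≤ Real.log q := Real.log_nonneg hq
  have hne : ∀ᵐ y : ℝ, y ≠ Real.log q := by simp [ae_iff]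
  filter_upwards [hne] with y hy
  refine propext ?_
  show q ≤ Real.exp y ∧ 0 < y ↔ Real.log q < y
  rw [← Real.log_le_iff_le_exp h0]
  exact ⟨fun h => lt_of_le_of_ne h.1 (Ne.symm hy), fun h => ⟨h.le, h1.trans_lt h⟩⟩

/-- The kernel for Fubini: with q = p a, integrating over a first produces the summatory function at
e^y, integrating over y first produces p(a)⁻ˢ/s. -/
theorem integral_indicator_mul_exp {q : ℝ} (hq : 1 ≤ q) {s : ℂ} (hs : 0 < s.re) :
    ∫ y in Ioi (0 : ℝ), {y : ℝ | q ≤ Real.exp y}.indicator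
      (fun y : ℝ => Complex.exp (-s * y)) y = (q : ℂ) ^ (-s) / s := by
  have h0 : 0 < q := by linarith
  have hm : MeasurableSet {y : ℝ | q ≤ Real.exp y} :=
    measurableSet_le measurable_const (by fun_prop)
  rw [integral_indicator hm, Measure.restrict_restrict hm,
    setIntegral_congr_set (setOf_le_exp_inter_Ioi_ae_eq hq),
    integral_exp_mul_complex_Ioi (by simpa), Complex.cpow_def_of_ne_zero (by exact_mod_cast h0.ne'),
    Complex.ofReal_log h0.le, neg_div_neg_eq, mul_comm (-s)]

theorem integral_indicator_norm_exp {q : ℝ} (hq : 1 ≤ q) {σ : ℝ} (hs : 0 < σ) :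
    ∫ y in Ioi (0 : ℝ), {y : ℝ | q ≤ Real.exp y}.indicator
      (fun y : ℝ => Real.exp (-σ * y)) y = q ^ (-σ) / σ := by
  have h0 : 0 < q := by linarith
  have hm : MeasurableSet {y : ℝ | q ≤ Real.exp y} :=
    measurableSet_le measurable_const (by fun_prop)
  rw [integral_indicator hm, Measure.restrict_restrict hm,
    setIntegral_congr_set (setOf_le_exp_inter_Ioi_ae_eq hq),
    integral_exp_mul_Ioi (by simpa), Real.rpow_def_of_pos h0, neg_div_neg_eq, mul_comm (-σ)]

variable [SFinite ν]

/-- The Mellin transform of a summatory function is the transform of the underlying measure. -/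
theorem integral_summatory_mul_exp (hh : AEStronglyMeasurable h ν) (hp : Measurable p)
    (hp1 : ∀ᵐ a ∂ν, 1 ≤ p a) {s : ℂ} (hs : 0 < s.re)
    (hi : Integrable (fun a => ‖h a‖ * p a ^ (-s.re)) ν) :
    IntegrableOn (fun y : ℝ => (∫ a in {a | p a ≤ Real.exp y}, h a ∂ν) * Complex.exp (-s * y))
      (Ioi 0) ∧
    ∫ y in Ioi (0 : ℝ), (∫ a in {a | p a ≤ Real.exp y}, h a ∂ν) * Complex.exp (-s * y) =
      (∫ a, h a * (p a : ℂ) ^ (-s) ∂ν) / s := by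
  set J : α → ℝ → ℂ := fun a y => h a * {y : ℝ | p a ≤ Real.exp y}.indicator
      (fun y : ℝ => Complex.exp (-s * y)) y with hJ
  have hset : MeasurableSet {z : α × ℝ | p z.1 ≤ Real.exp z.2} :=
    measurableSet_le (by fun_prop) (by fun_prop)
  have hJm : AEStronglyMeasurable (Function.uncurry J) (ν.prod (volume.restrict (Ioi 0))) := by
    refine (hh.comp_fst).mul (Measurable.aestronglyMeasurable ?_)
    have : Measurable ({z : α × ℝ | p z.1 ≤ Real.exp z.2}.indicator
      (fun z : α × ℝ => Complex.exp (-s * z.2))) := Measurable.indicator (by fun_prop) hset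
    exact this
  have hJn : ∀ a y, ‖J a y‖ = ‖h a‖ * {y : ℝ | p a ≤ Real.exp y}.indicator
      (fun y : ℝ => Real.exp (-s.re * y)) y := fun a y => by
    simp only [hJ, norm_mul, norm_indicator_eq_indicator_norm, Complex.norm_exp]
    simp
  have hJi : Integrable (Function.uncurry J) (ν.prod (volume.restrict (Ioi 0))) := by
    rw [integrable_prod_iff hJm]
    refine ⟨.of_forall fun a =>
      Integrable.const_mul (integrableOn_indicator_mul_exp (q := p a) hs) (h a), ?_⟩
    refine (hi.div_const s.re).congr ?_
    filter_upwards [hp1] with a ha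
    simp only [Function.uncurry_apply_pair, hJn]
    rw [integral_const_mul, integral_indicator_norm_exp ha hs]
    ring
  have hJy : ∀ y, ∫ a, J a y ∂ν =
      (∫ a in {a | p a ≤ Real.exp y}, h a ∂ν) * Complex.exp (-s * y) := fun y => by
    rw [← integral_indicator (measurableSet_le hp measurable_const), ← integral_mul_const]
    refine integral_congr_ae (.of_forall fun a => ?_)
    by_cases hpa : p a ≤ Real.exp y <;> simp [hJ, hpa]
  constructor
  · exact hJi.integral_prod_right.congr (.of_forall fun y => by simpa using! hJy y)
  · simp_rw [← hJy]
    rw [← integral_integral_swap hJi, ← integral_div]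
    refine integral_congr_ae ?_
    filter_upwards [hp1] with a ha
    simp only [hJ]
    rw [integral_const_mul, integral_indicator_mul_exp ha hs]
    ring

open scoped FourierTransform in
/-- Plancherel's formula for the Mellin transform of a summatory function. -/
theorem integral_norm_sq_mellin_div (hh : AEStronglyMeasurable h ν) (hp : Measurable p)
    (hp1 : ∀ᵐ a ∂ν, 1 ≤ p a) {σ : ℝ} (hs : 0 < σ)
    (hi : Integrable (fun a => ‖h a‖ * p a ^ (-σ)) ν)
    (h2 : IntegrableOn (fun y : ℝ => ‖∫ a in {a | p a ≤ Real.exp y}, h a ∂ν‖ ^ 2 *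
      Real.exp (-2 * y * σ)) (Ioi 0)) :
    Integrable (fun t : ℝ => ‖(∫ a, h a * (p a : ℂ) ^ (-(σ + t * Complex.I)) ∂ν) /
      (σ + t * Complex.I)‖ ^ 2) ∧
    ∫ t : ℝ, ‖(∫ a, h a * (p a : ℂ) ^ (-(σ + t * Complex.I)) ∂ν) / (σ + t * Complex.I)‖ ^ 2 =
      2 * Real.pi * ∫ y in Ioi (0 : ℝ), ‖∫ a in {a | p a ≤ Real.exp y}, h a ∂ν‖ ^ 2 *
      Real.exp (-2 * y * σ) := by
  set H : ℝ → ℂ := fun y => ∫ a in {a | p a ≤ Real.exp y}, h a ∂ν with hH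
  -- The Fourier transform of f at τ is the Mellin quotient at t = 2πτ; this rescaling is the source
  -- of the factor 2π.
  set f : ℝ → ℂ := (Ioi 0).indicator fun y => H y * Complex.exp (-(σ : ℂ) * y) with hf
  have key : ∀ t : ℝ, IntegrableOn (fun y : ℝ => H y * Complex.exp (-(σ + t * Complex.I) * y))
      (Ioi 0) ∧ ∫ y in Ioi (0 : ℝ), H y * Complex.exp (-(σ + t * Complex.I) * y) =
      (∫ a, h a * (p a : ℂ) ^ (-(σ + t * Complex.I)) ∂ν) / (σ + t * Complex.I) := fun t =>
    integral_summatory_mul_exp hh hp hp1 (s := σ + t * Complex.I) (by simpa) (by simpa)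
  have hf1 : Integrable f := by
    have := (key 0).1
    simp only [Complex.ofReal_zero, zero_mul, add_zero] at this
    exact this.integrable_indicator measurableSet_Ioi
  have hnf : ∀ y, ‖f y‖ ^ 2 = (Ioi 0).indicator (fun y => ‖H y‖ ^ 2 * Real.exp (-2 * y * σ)) y := by
    intro y
    by_cases hy : y ∈ Ioi (0 : ℝ)
    · simp only [hf, indicator_of_mem hy, norm_mul, Complex.norm_exp, mul_pow, ← Real.exp_nat_mul]
      congr 2
      simp
      ring
    · simp [hf, indicator_of_notMem hy]
  have hf2 : MemLp f 2 := by
    rw [memLp_two_iff_integrable_sq_norm hf1.1]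
    simp_rw [hnf]
    exact h2.integrable_indicator measurableSet_Ioi
  have hF : ∀ τ, 𝓕 f τ = (∫ a, h a * (p a : ℂ) ^ (-(σ + (2 * Real.pi * τ : ℝ) * Complex.I)) ∂ν) /
      (σ + (2 * Real.pi * τ : ℝ) * Complex.I) := fun τ => by
    rw [← (key _).2, Real.fourier_eq', ← integral_indicator measurableSet_Ioi]
    refine integral_congr_ae (.of_forall fun y => ?_)
    by_cases hy : y ∈ Ioi (0 : ℝ)
    · simp only [hf, indicator_of_mem hy, smul_eq_mul]
      rw [mul_left_comm, ← Complex.exp_add]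
      congr 2
      simp
      ring
    · simp [hf, indicator_of_notMem hy]
  obtain ⟨hI, hE⟩ := integral_norm_sq_fourier hf1 hf2
  set M : ℝ → ℝ := fun t => ‖(∫ a, h a * (p a : ℂ) ^ (-(σ + t * Complex.I)) ∂ν) /
      (σ + t * Complex.I)‖ ^ 2 with hM
  have hMF : (fun τ => ‖𝓕 f τ‖ ^ 2) = fun τ => M (2 * Real.pi * τ) := by
    ext τ; rw [hF]
  have hpi : 2 * Real.pi ≠ 0 := by positivity
  rw [hMF] at hI
  refine ⟨(integrable_comp_mul_left_iff M hpi).1 hI, ?_⟩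
  have e1 : ∫ τ, ‖𝓕 f τ‖ ^ 2 = |(2 * Real.pi)⁻¹| • ∫ t, M t := by
    rw [hMF, Measure.integral_comp_mul_left]
  have e2 : ∫ y, ‖f y‖ ^ 2 = ∫ y in Ioi (0 : ℝ), ‖H y‖ ^ 2 * Real.exp (-2 * y * σ) := by
    simp_rw [hnf]; exact integral_indicator measurableSet_Ioi
  rw [e1, e2, abs_of_pos (by positivity), smul_eq_mul] at hE
  rw [← hE]
  field_simp

end Mellin

/-! ### Integrals against complex measures with a density. -/

section VectorMeasureIntegral

variable {α β : Type*} [MeasurableSpace α] [MeasurableSpace β] {ν : Measure α}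

/-- Integration against the image of a complex measure with a density. -/
theorem integral_map_withDensityᵥ {φ : α → ℂ} {T : α → β} (hφ : Integrable φ ν)
    (hT : Measurable T) {f : β → ℂ}
    (hf : Integrable f ((ν.withDensity fun a => ‖φ a‖ₑ).map T)) :
    ((ν.withDensityᵥ φ).map T).integral f (ContinuousLinearMap.mul ℝ ℂ) =
      ∫ a, f (T a) * φ a ∂ν := by
  set ρ := (ν.withDensity fun a => ‖φ a‖ₑ).map T with hρ
  set m : ComplexMeasure β := (ν.withDensityᵥ φ).map T with hm
  have hm_apply : ∀ s, MeasurableSet s → m s = ∫ a in T ⁻¹' s, φ a ∂ν := fun s hs => by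
    rw [hm, VectorMeasure.map_apply _ hT hs, withDensityᵥ_apply hφ (hT hs)]
  have hfin : IsFiniteMeasure (ν.withDensity fun a => ‖φ a‖ₑ) :=
    isFiniteMeasure_withDensity hφ.2.ne
  have hle : m.variation ≤ ρ := by
    refine VectorMeasure.variation_le_of_forall_enorm_le fun s hs => ?_
    rw [hm_apply s hs, hρ, Measure.map_apply hT hs, withDensity_apply _ (hT hs)]
    exact enorm_integral_le_lintegral_enorm _
  have hle' : m.variation ≤ (1 : ENNReal) • ρ := by simpa using hle
  -- As ρ dominates the variation of m, the integral against m is a `setToFun` over ρ. The identity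
  -- can then be checked on indicators and extended by density in L¹(ρ).
  have hT1 : DominatedFinMeasAdditive ρ (m.transpose (ContinuousLinearMap.mul ℝ ℂ))
      ‖ContinuousLinearMap.mul ℝ ℂ‖ := by
    have := (dominatedFinMeasAdditive_cbmApplyMeasure m (ContinuousLinearMap.mul ℝ ℂ)).of_measure_le
      hle (norm_nonneg (ContinuousLinearMap.mul ℝ ℂ))
    exact this
  have hint : ∀ f : β → ℂ, Integrable f ρ → m.integral f (ContinuousLinearMap.mul ℝ ℂ) =
      setToFun ρ (m.transpose (ContinuousLinearMap.mul ℝ ℂ)) hT1 f := fun f hf =>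
    (setToFun_congr_measure_of_integrable 1 (by simp) hle' hT1 _ f hf).symm
  have hlin : ∀ f : β → ℂ, AEStronglyMeasurable f ρ →
      ∫⁻ a, ‖f (T a) * φ a‖ₑ ∂ν = ∫⁻ b, ‖f b‖ₑ ∂ρ := fun f hf => by
    have hfT : AEStronglyMeasurable (fun a => f (T a)) (ν.withDensity fun a => ‖φ a‖ₑ) :=
      hf.comp_measurable hT
    rw [hρ, lintegral_map' hf.enorm hT.aemeasurable,
      lintegral_withDensity_eq_lintegral_mul₀' hφ.1.enorm hfT.enorm]
    refine lintegral_congr fun a => ?_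
    simp [mul_comm]
  -- The preimage of a ρ-null set is ν-null only off the zeros of φ; on those zeros the product
  -- vanishes whatever the value of f.
  have hmeas : ∀ f : β → ℂ, AEStronglyMeasurable f ρ →
      AEStronglyMeasurable (fun a => f (T a) * φ a) ν := fun f hf => by
    obtain ⟨f', hf', he⟩ := hf
    refine ⟨fun a => f' (T a) * hφ.1.mk φ a,
      (hf'.comp_measurable hT).mul hφ.1.stronglyMeasurable_mk, ?_⟩
    have h1 := ae_of_ae_map hT.aemeasurable he
    rw [ae_withDensity_iff' hφ.1.enorm] at h1
    filter_upwards [h1, hφ.1.ae_eq_mk] with a ha hb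
    by_cases h0 : φ a = 0
    · simp [← hb, h0]
    · rw [← hb, ha (by simpa using h0)]
  have hInt : ∀ f : β → ℂ, Integrable f ρ → Integrable (fun a => f (T a) * φ a) ν :=
    fun f hf => ⟨hmeas f hf.1, by rw [HasFiniteIntegral, hlin f hf.1]; exact hf.2⟩
  refine Integrable.induction (P := fun f => m.integral f (ContinuousLinearMap.mul ℝ ℂ) =
      ∫ a, f (T a) * φ a ∂ν) ?_ ?_ ?_ ?_ hf
  · intro c s hs hsf
    have hsi : Integrable (s.indicator fun _ => c) ρ := (integrable_const c).indicator hs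
    rw [hint _ hsi, setToFun_indicator_const hT1 hs hsf.ne]
    have : (fun a => s.indicator (fun _ => c) (T a) * φ a) =
        (T ⁻¹' s).indicator (fun a => c * φ a) := by
      ext a; by_cases h : T a ∈ s <;> simp [h]
    rw [this, integral_indicator (hT hs), integral_const_mul, ← hm_apply s hs]
    rfl
  · intro f g _ hf hg ef eg
    rw [hint _ (hf.add hg), setToFun_add _ hf hg, ← hint f hf, ← hint g hg, ef, eg,
      ← integral_add (hInt f hf) (hInt g hg)]
    simp [add_mul]
  · have h1 : Continuous fun f : β →₁[ρ] ℂ =>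
        m.integral (f : β → ℂ) (ContinuousLinearMap.mul ℝ ℂ) := by
      simp_rw [fun f : β →₁[ρ] ℂ => hint f (L1.integrable_coeFn f)]
      exact continuous_setToFun hT1
    have h2 : LipschitzWith 1 fun f : β →₁[ρ] ℂ => ∫ a, f (T a) * φ a ∂ν := by
      intro f g
      have hf := L1.integrable_coeFn f
      have hg := L1.integrable_coeFn g
      rw [edist_eq_enorm_sub, ← integral_sub (hInt f hf) (hInt g hg), L1.edist_def,
        ENNReal.coe_one, one_mul]
      refine (enorm_integral_le_lintegral_enorm _).trans ?_
      simp_rw [← sub_mul, edist_eq_enorm_sub]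
      exact (hlin _ (hf.sub hg).1).le
    exact isClosed_eq h1 h2.continuous
  · intro f g hfg hf ef
    rw [← VectorMeasure.integral_congr_ae (Measure.absolutelyContinuous_of_le hle hfg), ef]
    refine integral_congr_ae ?_
    have h1 := ae_of_ae_map hT.aemeasurable hfg
    rw [ae_withDensity_iff' hφ.1.enorm] at h1
    filter_upwards [h1] with a ha
    by_cases h0 : φ a = 0
    · simp [h0]
    · rw [ha (by simpa using h0)]

end VectorMeasureIntegral

/-! ### Integration over tuples and the exponential formula. -/

section Tuples

theorem measurable_sigmaMk_tuples (n : ℕ) :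
    Measurable (fun x : Fin n → ℝ => (⟨n, x⟩ : Tuples)) :=
  Measurable.of_le_map (iInf_le _ n)

theorem measurable_tuples {γ : Type*} [MeasurableSpace γ] {f : Tuples → γ}
    (h : ∀ n, Measurable fun x : Fin n → ℝ => f ⟨n, x⟩) : Measurable f := by
  intro s hs
  exact MeasurableSpace.measurableSet_iInf.2 fun n => h n hs

theorem measurable_prod_pi {M : Type*} [CommMonoid M] [MeasurableSpace M] [MeasurableMul₂ M]
    {f : ℝ → M} (hf : Measurable f) (n : ℕ) : Measurable fun x : Fin n → ℝ => ∏ i, f (x i) :=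
  Finset.measurable_fun_prod Finset.univ fun i _ => hf.comp (measurable_pi_apply i)

theorem measurable_prod_tuples {M : Type*} [CommMonoid M] [MeasurableSpace M] [MeasurableMul₂ M]
    {f : ℝ → M} (hf : Measurable f) : Measurable fun c : Tuples => ∏ i, f (c.2 i) :=
  measurable_tuples (measurable_prod_pi hf)

theorem measurable_tupleProd : Measurable tupleProd :=
  measurable_prod_tuples measurable_id

theorem measurableEmbedding_sigmaMk_tuples (n : ℕ) :
    MeasurableEmbedding (fun x : Fin n → ℝ => (⟨n, x⟩ : Tuples)) where
  injective := fun x y h => by simpa using h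
  measurable := measurable_sigmaMk_tuples n
  measurableSet_image' := fun {s} hs => by
    refine MeasurableSpace.measurableSet_iInf.2 fun m => ?_
    change MeasurableSet ((fun x : Fin m → ℝ => (⟨m, x⟩ : Tuples)) ⁻¹' _)
    by_cases h : m = n
    · subst h
      convert! hs
      ext x
      simp
    · convert! MeasurableSet.empty
      ext x
      simp only [mem_preimage, mem_image, mem_empty_iff_false, iff_false, not_exists, not_and]
      intro y _ hy
      exact h (congrArg Sigma.fst hy).symm

variable {μ : Measure ℝ}

instance [SigmaFinite μ] : SFinite (tupleMeasure μ) := by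
  unfold tupleMeasure; infer_instance

theorem ae_tupleMeasure [SigmaFinite μ] {P : ℝ → Prop} (h : ∀ᵐ u ∂μ, P u) :
    ∀ᵐ c ∂tupleMeasure μ, ∀ i, P (c.2 i) := by
  rw [tupleMeasure, Measure.ae_sum_iff]
  intro n
  refine Measure.ae_smul_measure ?_ _
  rw [(measurableEmbedding_sigmaMk_tuples n).ae_map_iff]
  refine ae_all_iff.2 fun i : Fin n => ?_
  exact (Measure.quasiMeasurePreserving_eval (fun _ : Fin n => μ) i).ae h

theorem lintegral_tupleMeasure {f : Tuples → ENNReal} (hf : Measurable f) :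
    ∫⁻ c, f c ∂tupleMeasure μ =
      ∑' n : ℕ, (n.factorial : ENNReal)⁻¹ * ∫⁻ x : Fin n → ℝ, f ⟨n, x⟩ ∂Measure.pi fun _ => μ := by
  rw [tupleMeasure, lintegral_sum_measure]
  refine tsum_congr fun n => ?_
  rw [lintegral_smul_measure, lintegral_map hf (measurable_sigmaMk_tuples n), smul_eq_mul]

theorem lintegral_pi_prod [SigmaFinite μ] {f : ℝ → ENNReal} (hf : Measurable f) (n : ℕ) :
    ∫⁻ x : Fin n → ℝ, ∏ i, f (x i) ∂(Measure.pi fun _ => μ) = (∫⁻ u, f u ∂μ) ^ n := by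
  induction n with
  | zero => simp
  | succ n ih =>
    have := (measurePreserving_piFinSuccAbove (fun _ : Fin (n + 1) => μ) 0).lintegral_comp_emb
      (MeasurableEquiv.measurableEmbedding _) (fun z => f z.1 * ∏ i, f (z.2 i))
    simp only [Fin.prod_univ_succ]
    refine this.trans ?_
    rw [lintegral_prod_mul (g := fun x : Fin n → ℝ => ∏ i, f (x i)) hf.aemeasurable
      (measurable_prod_pi hf n).aemeasurable, ih,
      pow_succ']

/-- The layer of n-tuples contributes an n-th power, so the weights 1/n! produce the exponential
series. The complex counterpart is `integral_prod_tupleMeasure`. -/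
theorem lintegral_prod_tupleMeasure [SigmaFinite μ] {f : ℝ → ENNReal} (hf : Measurable f) :
    ∫⁻ c, ∏ i, f (c.2 i) ∂tupleMeasure μ =
      ∑' n : ℕ, (n.factorial : ENNReal)⁻¹ * (∫⁻ u, f u ∂μ) ^ n := by
  rw [lintegral_tupleMeasure (measurable_prod_tuples hf)]
  simp_rw [lintegral_pi_prod hf]

theorem tsum_inv_factorial_mul_pow {a : ENNReal} (ha : a ≠ ⊤) :
    ∑' n : ℕ, (n.factorial : ENNReal)⁻¹ * a ^ n = ENNReal.ofReal (Real.exp a.toReal) := by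
  have h : HasSum (fun n : ℕ => a.toReal ^ n / n.factorial) (Real.exp a.toReal) := by
    rw [Real.exp_eq_exp_ℝ]
    exact NormedSpace.expSeries_div_hasSum_exp a.toReal
  rw [← h.tsum_eq, ENNReal.ofReal_tsum_of_nonneg (fun n => by positivity) h.summable]
  refine tsum_congr fun n => ?_
  rw [ENNReal.ofReal_div_of_pos (by positivity), ENNReal.ofReal_pow ENNReal.toReal_nonneg,
    ENNReal.ofReal_toReal ha, ENNReal.ofReal_natCast, ENNReal.div_eq_inv_mul]

theorem integrable_prod_tupleMeasure [SigmaFinite μ] {g : ℝ → ℂ} (hg : Measurable g)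
    (hi : Integrable g μ) : Integrable (fun c : Tuples => ∏ i, g (c.2 i)) (tupleMeasure μ) := by
  refine ⟨(measurable_prod_tuples hg).aestronglyMeasurable, ?_⟩
  have : ∀ c : Tuples, ‖∏ i, g (c.2 i)‖ₑ = ∏ i, ‖g (c.2 i)‖ₑ := fun c => by
    simp_rw [enorm_eq_nnnorm, nnnorm_prod, ENNReal.ofNNReal_finsetProd]
  simp_rw [HasFiniteIntegral, this]
  rw [lintegral_prod_tupleMeasure hg.enorm, tsum_inv_factorial_mul_pow hi.2.ne]
  exact ENNReal.ofReal_lt_top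

theorem integral_prod_tupleMeasure [SigmaFinite μ] {g : ℝ → ℂ} (hg : Measurable g)
    (hi : Integrable g μ) :
    ∫ c, ∏ i, g (c.2 i) ∂tupleMeasure μ = Complex.exp (∫ u, g u ∂μ) := by
  have h := hasSum_integral_measure (integrable_prod_tupleMeasure hg hi)
  have h' : HasSum (fun n : ℕ => (n.factorial : ℂ)⁻¹ • (∫ u, g u ∂μ) ^ n)
      (Complex.exp (∫ u, g u ∂μ)) := by
    rw [Complex.exp_eq_exp_ℂ]
    exact NormedSpace.exp_series_hasSum_exp' (𝕂 := ℂ) (∫ u, g u ∂μ)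
  refine h.unique ?_
  convert! h' using 2 with n
  rw [integral_smul_measure, (measurableEmbedding_sigmaMk_tuples n).integral_map,
    integral_fintype_prod_eq_pow, Fintype.card_fin]
  simp

end Tuples

/-! ### The truncated measure dG and the Euler product. -/

section TupleEstimates

variable {μ : Measure ℝ} {g : ℝ → ℂ}

theorem ae_pi_of_ae [SigmaFinite μ] {P : ℝ → Prop} (h : ∀ᵐ u ∂μ, P u) (n : ℕ) :
    ∀ᵐ x : Fin n → ℝ ∂Measure.pi fun _ => μ, ∀ i, P (x i) :=
  ae_all_iff.2 fun i => (Measure.quasiMeasurePreserving_eval (fun _ : Fin n => μ) i).ae h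

theorem one_le_prod_real {ι : Type*} (s : Finset ι) {x : ι → ℝ} (h : ∀ i, 1 ≤ x i) :
    1 ≤ ∏ i ∈ s, x i := by
  simpa using Finset.prod_le_prod (s := s) (f := fun _ => (1 : ℝ)) (fun _ _ => zero_le_one)
    fun i _ => h i

theorem single_le_prod_real {ι : Type*} [Fintype ι] {x : ι → ℝ} (h : ∀ i, 1 ≤ x i) (j : ι) :
    x j ≤ ∏ i, x i := by
  classical
  rw [← Finset.mul_prod_erase _ _ (Finset.mem_univ j)]
  exact le_mul_of_one_le_right (zero_le_one.trans (h j)) (one_le_prod_real _ h)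

theorem prod_ofReal_cpow {ι : Type*} (t : Finset ι) {x : ι → ℝ} (h : ∀ i, 0 ≤ x i) (s : ℂ) :
    ((∏ i ∈ t, x i : ℝ) : ℂ) ^ s = ∏ i ∈ t, (x i : ℂ) ^ s := by
  classical
  induction t using Finset.induction_on with
  | empty => simp
  | insert a t ha ih =>
    rw [Finset.prod_insert ha, Finset.prod_insert ha, Complex.ofReal_mul,
      Complex.mul_cpow_ofReal_nonneg (h a) (Finset.prod_nonneg fun i _ => h i), ih]

theorem ae_one_le_tupleProd [SigmaFinite μ] (hμ : ∀ᵐ u ∂μ, 1 ≤ u) :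
    ∀ᵐ c ∂tupleMeasure μ, 1 ≤ tupleProd c := by
  filter_upwards [ae_tupleMeasure hμ] with c hc
  exact one_le_prod_real _ hc

theorem measurableSet_tupleProd_le (X : ℝ) : MeasurableSet {c | tupleProd c ≤ X} :=
  measurableSet_le measurable_tupleProd measurable_const

theorem measurableSet_tupleProd_mem (X : ℝ) : MeasurableSet {c | tupleProd c ∈ Icc 1 X} :=
  measurable_tupleProd measurableSet_Icc

theorem tupleProd_mem_ae_eq [SigmaFinite μ] (hμ : ∀ᵐ u ∂μ, 1 ≤ u) (X : ℝ) :
    {c | tupleProd c ∈ Icc 1 X} =ᵐ[tupleMeasure μ] {c | tupleProd c ≤ X} := by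
  filter_upwards [ae_one_le_tupleProd hμ] with c hc
  exact propext ⟨fun h => h.2, fun h => ⟨hc, h⟩⟩

/-- When all entries are at least 1, a product at most X forces every entry into [1, X], so g may be
replaced by its truncation, which is integrable on the whole line. -/
theorem integrableOn_prod_tupleMeasure [SigmaFinite μ] (hμ : ∀ᵐ u ∂μ, 1 ≤ u) (hg : Measurable g)
    {X : ℝ} (hi : IntegrableOn g (Icc 1 X) μ) :
    IntegrableOn (fun c : Tuples => ∏ i, g (c.2 i)) {c | tupleProd c ≤ X} (tupleMeasure μ) := by
  have h := (integrable_prod_tupleMeasure (hg.indicator (measurableSet_Icc (a := 1) (b := X)))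
    (hi.integrable_indicator measurableSet_Icc)).integrableOn (s := {c | tupleProd c ≤ X})
  refine h.congr ?_
  filter_upwards [ae_restrict_of_ae (ae_tupleMeasure hμ),
    ae_restrict_mem (measurableSet_tupleProd_le X)] with c hc hX
  exact Finset.prod_congr rfl fun i _ =>
    indicator_of_mem (show c.2 i ∈ Icc 1 X from ⟨hc i, (single_le_prod_real hc i).trans hX⟩) _

theorem convExpDensity_Icc [SigmaFinite μ] (hμ : ∀ᵐ u ∂μ, 1 ≤ u) (hg : Measurable g)
    {X : ℝ} (hi : IntegrableOn g (Icc 1 X) μ) :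
    convExpDensity μ g X (Icc 1 X) =
      ∫ c in {c | tupleProd c ≤ X}, ∏ i, g (c.2 i) ∂tupleMeasure μ := by
  have h := integrableOn_prod_tupleMeasure hμ hg hi
  rw [← integrableOn_congr_set_ae (tupleProd_mem_ae_eq hμ X)] at h
  rw [convExpDensity, VectorMeasure.map_apply _ measurable_tupleProd measurableSet_Icc,
    withDensityᵥ_apply h (measurable_tupleProd measurableSet_Icc),
    Measure.restrict_restrict (measurable_tupleProd measurableSet_Icc),
    ← setIntegral_congr_set (tupleProd_mem_ae_eq hμ X)]
  congr 2
  exact inter_self _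

theorem norm_ofReal_cpow_neg {u : ℝ} (hu : 0 < u) (s : ℂ) : ‖(u : ℂ) ^ (-s)‖ = u ^ (-s.re) := by
  rw [Complex.norm_cpow_eq_rpow_re_of_pos hu, Complex.neg_re]

theorem convExpDensity_integral_cpow [SigmaFinite μ] (hμ : ∀ᵐ u ∂μ, 1 ≤ u) (hg : Measurable g)
    {X : ℝ} (hi : IntegrableOn g (Icc 1 X) μ) {s : ℂ} (hs : 0 ≤ s.re) :
    (convExpDensity μ g X).integral (fun u => (u : ℂ) ^ (-s)) (ContinuousLinearMap.mul ℝ ℂ) =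
      ∫ c in {c | tupleProd c ≤ X}, (∏ i, g (c.2 i)) * (tupleProd c : ℂ) ^ (-s)
        ∂tupleMeasure μ := by
  have h := integrableOn_prod_tupleMeasure hμ hg hi
  rw [← integrableOn_congr_set_ae (tupleProd_mem_ae_eq hμ X)] at h
  have hm : Measurable fun u : ℝ => (u : ℂ) ^ (-s) := by fun_prop
  have hfin := isFiniteMeasure_withDensity (μ := (tupleMeasure μ).restrict _) h.2.ne
  have hf : Integrable (fun u : ℝ => (u : ℂ) ^ (-s))
      ((((tupleMeasure μ).restrict {c | tupleProd c ∈ Icc 1 X}).withDensity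
        fun c => ‖∏ i, g (c.2 i)‖ₑ).map tupleProd) := by
    refine Integrable.of_bound hm.aestronglyMeasurable 1 ?_
    rw [ae_map_iff measurable_tupleProd.aemeasurable
      (measurableSet_le hm.norm measurable_const)]
    refine (withDensity_absolutelyContinuous _ _).ae_le ?_
    filter_upwards [ae_restrict_mem (measurableSet_tupleProd_mem X)] with c hc
    have h1 : 1 ≤ tupleProd c := hc.1
    rw [norm_ofReal_cpow_neg (by linarith)]
    exact Real.rpow_le_one_of_one_le_of_nonpos h1 (by linarith)
  rw [convExpDensity, integral_map_withDensityᵥ h measurable_tupleProd hf,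
    ← setIntegral_congr_set (tupleProd_mem_ae_eq hμ X)]
  simp_rw [mul_comm]

theorem prod_mul_cpow_ae_eq [SigmaFinite μ] (hμ : ∀ᵐ u ∂μ, 1 ≤ u) (g : ℝ → ℂ) (s : ℂ) :
    (fun c : Tuples => ∏ i, (g (c.2 i) * (c.2 i : ℂ) ^ (-s))) =ᵐ[tupleMeasure μ]
      fun c => (∏ i, g (c.2 i)) * (tupleProd c : ℂ) ^ (-s) := by
  filter_upwards [ae_tupleMeasure hμ] with c hc
  rw [Finset.prod_mul_distrib, tupleProd,
    prod_ofReal_cpow _ fun i => zero_le_one.trans (hc i)]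

theorem integrable_mul_cpow (hμ : ∀ᵐ u ∂μ, 1 ≤ u) (hg : Measurable g) {s : ℂ}
    (hi : Integrable (fun u => ‖g u‖ * u ^ (-s.re)) μ) :
    Integrable (fun u => g u * (u : ℂ) ^ (-s)) μ := by
  refine hi.mono' (by fun_prop) ?_
  filter_upwards [hμ] with u hu
  rw [norm_mul, norm_ofReal_cpow_neg (by linarith)]

theorem integrable_prod_mul_cpow [SigmaFinite μ] (hμ : ∀ᵐ u ∂μ, 1 ≤ u) (hg : Measurable g) {s : ℂ}
    (hi : Integrable (fun u => ‖g u‖ * u ^ (-s.re)) μ) :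
    Integrable (fun c => (∏ i, g (c.2 i)) * (tupleProd c : ℂ) ^ (-s)) (tupleMeasure μ) :=
  (integrable_prod_tupleMeasure (by fun_prop) (integrable_mul_cpow hμ hg hi)).congr
    (prod_mul_cpow_ae_eq hμ g s)

/-- The Euler product `∫ u⁻ˢ dG(u) = exp (∫ g(u) u⁻ˢ dμ(u))`. -/
theorem integral_prod_mul_cpow [SigmaFinite μ] (hμ : ∀ᵐ u ∂μ, 1 ≤ u) (hg : Measurable g) {s : ℂ}
    (hi : Integrable (fun u => ‖g u‖ * u ^ (-s.re)) μ) :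
    ∫ c, (∏ i, g (c.2 i)) * (tupleProd c : ℂ) ^ (-s) ∂tupleMeasure μ =
      Complex.exp (∫ u, g u * (u : ℂ) ^ (-s) ∂μ) := by
  rw [← integral_congr_ae (prod_mul_cpow_ae_eq hμ g s)]
  exact integral_prod_tupleMeasure (by fun_prop) (integrable_mul_cpow hμ hg hi)

/-- The truncated transforms are integrals of one fixed integrable function over the sets `tupleProd
c ≤ X`, which exhaust the tuples; dominated convergence applies. -/
theorem tendsto_convExpDensity_integral_cpow [SigmaFinite μ] (hμ : ∀ᵐ u ∂μ, 1 ≤ u)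
    (hg : Measurable g) (hloc : ∀ X, IntegrableOn g (Icc 1 X) μ) {s : ℂ} (hs : 0 ≤ s.re)
    (hi : Integrable (fun u => ‖g u‖ * u ^ (-s.re)) μ) :
    Filter.Tendsto (fun X => (convExpDensity μ g X).integral (fun u => (u : ℂ) ^ (-s))
      (ContinuousLinearMap.mul ℝ ℂ)) Filter.atTop
      (nhds (Complex.exp (∫ u, g u * (u : ℂ) ^ (-s) ∂μ))) := by
  rw [← integral_prod_mul_cpow hμ hg hi]
  simp_rw [fun X => convExpDensity_integral_cpow hμ hg (hloc X) hs]
  have hI := integrable_prod_mul_cpow hμ hg hi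
  simp_rw [← fun X => integral_indicator (μ := tupleMeasure μ)
    (f := fun c => (∏ i, g (c.2 i)) * (tupleProd c : ℂ) ^ (-s)) (measurableSet_tupleProd_le X)]
  refine tendsto_integral_filter_of_dominated_convergence _
    (.of_forall fun X => hI.1.indicator (measurableSet_tupleProd_le X))
    (.of_forall fun X => .of_forall fun c => norm_indicator_le_norm_self _ _) hI.norm
    (.of_forall fun c => ?_)
  refine tendsto_const_nhds.congr' ?_
  filter_upwards [Filter.eventually_ge_atTop (tupleProd c)] with X hX
  rw [indicator_of_mem]
  exact hX

end TupleEstimates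

/-! ### The upper bound for exponentials of positive measures. -/

section SummatoryBound

variable {μ : Measure ℝ} {f : ℝ → ENNReal}

theorem ofReal_log_prod_le {n : ℕ} {x : Fin n → ℝ} (h : ∀ i, 1 ≤ x i) :
    ENNReal.ofReal (Real.log (∏ i, x i)) ≤ ∑ i, ENNReal.ofReal (Real.log (x i)) := by
  rw [Real.log_prod fun i _ => (zero_lt_one.trans_le (h i)).ne',
    ENNReal.ofReal_sum_of_nonneg fun i _ => Real.log_nonneg (h i)]

/-- With the entries other than the i-th fixed and of product q, the i-th runs over u ≤ x/q, and
`hK` at x/q yields K x/q. If q > x nothing is left, since entries are at least 1. -/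
theorem lintegral_pi_mul_log_le [SigmaFinite μ] (hμ : ∀ᵐ u ∂μ, 1 ≤ u) (hf : Measurable f)
    {K : ℝ} (hK : ∀ x : ℝ, 1 ≤ x →
      ∫⁻ u in {u | u ≤ x}, f u * ENNReal.ofReal (Real.log u) ∂μ ≤ ENNReal.ofReal (K * x))
    {x : ℝ} (hx : 1 ≤ x) (n : ℕ) (i : Fin (n + 1)) :
    ∫⁻ c : Fin (n + 1) → ℝ, {c : Fin (n + 1) → ℝ | ∏ j, c j ≤ x}.indicator
        (fun c => (∏ j, f (c j)) * ENNReal.ofReal (Real.log (c i))) c ∂(Measure.pi fun _ => μ) ≤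
      ENNReal.ofReal (K * x) * ∫⁻ r : Fin n → ℝ, {r : Fin n → ℝ | ∏ j, r j ≤ x}.indicator
        (fun r => (∏ j, f (r j)) * ENNReal.ofReal (∏ j, r j)⁻¹) r ∂(Measure.pi fun _ => μ) := by
  have hset : MeasurableSet {z : ℝ × (Fin n → ℝ) | z.1 * ∏ j, z.2 j ≤ x} :=
    measurableSet_le (measurable_fst.mul ((measurable_prod_pi measurable_id n).comp measurable_snd))
      measurable_const
  set Φ : ℝ × (Fin n → ℝ) → ENNReal := {z : ℝ × (Fin n → ℝ) | z.1 * ∏ j, z.2 j ≤ x}.indicator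
    fun z => (∏ j, f (z.2 j)) * (f z.1 * ENNReal.ofReal (Real.log z.1)) with hΦ
  have hw : Measurable fun u => f u * ENNReal.ofReal (Real.log u) := by fun_prop
  have hΦm : Measurable Φ := by
    refine Measurable.indicator ?_ hset
    exact ((measurable_prod_pi hf n).comp measurable_snd).mul (hw.comp measurable_fst)
  have e := (measurePreserving_piFinSuccAbove (fun _ : Fin (n + 1) => μ) i).lintegral_comp hΦm
  have hinv : Measurable fun r : Fin n → ℝ => ENNReal.ofReal (∏ j, r j)⁻¹ :=
    (measurable_prod_pi measurable_id n).inv.ennreal_ofReal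
  have hset' : MeasurableSet {r : Fin n → ℝ | ∏ j, r j ≤ x} :=
    measurableSet_le (measurable_prod_pi measurable_id n) measurable_const
  calc _ = ∫⁻ c : Fin (n + 1) → ℝ, Φ (MeasurableEquiv.piFinSuccAbove (fun _ => ℝ) i c)
          ∂(Measure.pi fun _ => μ) := by
        refine lintegral_congr fun c => ?_
        have hc : c i * ∏ j : Fin n, c (i.succAbove j) = ∏ j, c j :=
          (Fin.prod_univ_succAbove c i).symm
        have hc' : f (c i) * ∏ j : Fin n, f (c (i.succAbove j)) = ∏ j, f (c j) :=
          (Fin.prod_univ_succAbove (fun j => f (c j)) i).symm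
        have h1 : (MeasurableEquiv.piFinSuccAbove (fun _ => ℝ) i c).1 = c i := rfl
        have h2 : ∀ j, (MeasurableEquiv.piFinSuccAbove (fun _ => ℝ) i c).2 j =
          c (i.succAbove j) := fun j => rfl
        by_cases h : ∏ j, c j ≤ x
        · rw [indicator_of_mem (by exact h), hΦ, indicator_of_mem]
          · simp only [h1, h2]
            rw [← hc']
            ring
          · simp only [mem_ofPred_eq, h1, h2]
            rwa [hc]
        · rw [indicator_of_notMem (by exact h), hΦ, indicator_of_notMem]
          simp only [mem_ofPred_eq, h1, h2]
          rwa [hc]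
    _ = ∫⁻ r, ∫⁻ v, Φ (v, r) ∂μ ∂(Measure.pi fun _ => μ) := by
        rw [e, lintegral_prod_symm _ hΦm.aemeasurable]
    _ ≤ ∫⁻ r : Fin n → ℝ, ENNReal.ofReal (K * x) * {r : Fin n → ℝ | ∏ j, r j ≤ x}.indicator
          (fun r => (∏ j, f (r j)) * ENNReal.ofReal (∏ j, r j)⁻¹) r ∂(Measure.pi fun _ => μ) := by
        refine lintegral_mono_ae ?_
        filter_upwards [ae_pi_of_ae hμ n] with r hr
        set q := ∏ j, r j with hq
        have hq1 : 1 ≤ q := one_le_prod_real _ hr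
        have hq0 : 0 < q := by linarith
        by_cases h : q ≤ x
        · rw [indicator_of_mem (by exact h)]
          have h1 : ∀ v, Φ (v, r) = (∏ j, f (r j)) * {u | u ≤ x / q}.indicator
              (fun u => f u * ENNReal.ofReal (Real.log u)) v := fun v => by
            by_cases hv : v ≤ x / q
            · rw [hΦ, indicator_of_mem, indicator_of_mem (by exact hv)]
              exact (le_div_iff₀ hq0).1 hv
            · rw [hΦ, indicator_of_notMem, indicator_of_notMem (by exact hv), mul_zero]
              exact fun h' => hv ((le_div_iff₀ hq0).2 h')
          have hms : MeasurableSet {u : ℝ | u ≤ x / q} := measurableSet_Iic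
          simp_rw [h1]
          rw [lintegral_const_mul _ (hw.indicator hms), lintegral_indicator hms]
          refine (mul_le_mul_right (hK (x / q) ((one_le_div hq0).2 h)) _).trans_eq ?_
          have : K * (x / q) = (K * x) * q⁻¹ := by field_simp
          rw [this, ENNReal.ofReal_mul' (by positivity)]
          ring
        · rw [indicator_of_notMem (by exact h), mul_zero, nonpos_iff_eq_zero]
          refine lintegral_eq_zero_of_ae_eq_zero ?_
          filter_upwards [hμ] with v hv
          rw [hΦ, indicator_of_notMem]
          · rfl
          · intro h'
            have h'' : v * q ≤ x := h'
            nlinarith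
    _ = _ := lintegral_const_mul _ (((measurable_prod_pi hf n).mul hinv).indicator hset')

/-- The mean value inequality `∫_{u ≤ x} log u dF(u) ≤ K x ∫_{u ≤ x} dF(u) / u`. -/
theorem setLIntegral_mul_log_le [SigmaFinite μ] (hμ : ∀ᵐ u ∂μ, 1 ≤ u) (hf : Measurable f)
    {K : ℝ} (hK : ∀ x : ℝ, 1 ≤ x →
      ∫⁻ u in {u | u ≤ x}, f u * ENNReal.ofReal (Real.log u) ∂μ ≤ ENNReal.ofReal (K * x))
    {x : ℝ} (hx : 1 ≤ x) :
    ∫⁻ c in {c | tupleProd c ≤ x}, (∏ i, f (c.2 i)) * ENNReal.ofReal (Real.log (tupleProd c))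
        ∂tupleMeasure μ ≤
      ENNReal.ofReal (K * x) * ∫⁻ c in {c | tupleProd c ≤ x},
        (∏ i, f (c.2 i)) * ENNReal.ofReal (tupleProd c)⁻¹ ∂tupleMeasure μ := by
  have hset := measurableSet_tupleProd_le x
  have hm1 : Measurable fun c : Tuples =>
      (∏ i, f (c.2 i)) * ENNReal.ofReal (Real.log (tupleProd c)) :=
    (measurable_prod_tuples hf).mul (Real.measurable_log.comp measurable_tupleProd).ennreal_ofReal
  have hm2 : Measurable fun c : Tuples => (∏ i, f (c.2 i)) * ENNReal.ofReal (tupleProd c)⁻¹ :=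
    (measurable_prod_tuples hf).mul measurable_tupleProd.inv.ennreal_ofReal
  rw [← lintegral_indicator hset, ← lintegral_indicator hset,
    lintegral_tupleMeasure (hm1.indicator hset), lintegral_tupleMeasure (hm2.indicator hset),
    ← ENNReal.tsum_mul_left, tsum_eq_zero_add' ENNReal.summable]
  -- The empty tuple has product 1 and log 1 = 0, so the n-th term on the right is compared with the
  -- (n + 1)-st on the left.
  have h0 : ∫⁻ c : Fin 0 → ℝ, {c | tupleProd c ≤ x}.indicator (fun c : Tuples =>
      (∏ i, f (c.2 i)) * ENNReal.ofReal (Real.log (tupleProd c))) ⟨0, c⟩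
        ∂(Measure.pi fun _ => μ) = 0 := by
    simp [tupleProd, indicator]
  rw [h0, mul_zero, zero_add]
  refine ENNReal.tsum_le_tsum fun n => ?_
  have hmi : ∀ i : Fin (n + 1), Measurable fun c : Fin (n + 1) → ℝ =>
      {c : Fin (n + 1) → ℝ | ∏ j, c j ≤ x}.indicator
        (fun c => (∏ j, f (c j)) * ENNReal.ofReal (Real.log (c i))) c := fun i => by
    refine Measurable.indicator ?_
      (measurableSet_le (measurable_prod_pi measurable_id _) measurable_const)
    exact (measurable_prod_pi hf _).mul (by fun_prop)
  calc _ ≤ ((n + 1).factorial : ENNReal)⁻¹ * ∫⁻ c : Fin (n + 1) → ℝ, ∑ i,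
        {c : Fin (n + 1) → ℝ | ∏ j, c j ≤ x}.indicator
          (fun c => (∏ j, f (c j)) * ENNReal.ofReal (Real.log (c i))) c
          ∂(Measure.pi fun _ => μ) := by
        refine mul_le_mul_right (lintegral_mono_ae ?_) _
        filter_upwards [ae_pi_of_ae hμ (n + 1)] with c hc
        by_cases h : ∏ j, c j ≤ x
        · rw [indicator_of_mem (by exact h)]
          simp_rw [indicator_of_mem (show c ∈ {c : Fin (n + 1) → ℝ | ∏ j, c j ≤ x} from h)]
          rw [← Finset.mul_sum]
          exact mul_le_mul_right (ofReal_log_prod_le hc) _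
        · rw [indicator_of_notMem (by exact h)]
          exact zero_le
    _ = ((n + 1).factorial : ENNReal)⁻¹ * ∑ i, ∫⁻ c : Fin (n + 1) → ℝ,
        {c : Fin (n + 1) → ℝ | ∏ j, c j ≤ x}.indicator
          (fun c => (∏ j, f (c j)) * ENNReal.ofReal (Real.log (c i))) c
          ∂(Measure.pi fun _ => μ) := by
        rw [lintegral_finsetSum _ fun i _ => hmi i]
    _ ≤ ((n + 1).factorial : ENNReal)⁻¹ * ∑ _i : Fin (n + 1), ENNReal.ofReal (K * x) *
        ∫⁻ r : Fin n → ℝ, {r : Fin n → ℝ | ∏ j, r j ≤ x}.indicator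
        (fun r => (∏ j, f (r j)) * ENNReal.ofReal (∏ j, r j)⁻¹) r ∂(Measure.pi fun _ => μ) := by
        gcongr with i
        exact lintegral_pi_mul_log_le hμ hf hK hx n i
    _ = ENNReal.ofReal (K * x) * ((n.factorial : ENNReal)⁻¹ *
        ∫⁻ r : Fin n → ℝ, {r : Fin n → ℝ | ∏ j, r j ≤ x}.indicator
        (fun r => (∏ j, f (r j)) * ENNReal.ofReal (∏ j, r j)⁻¹) r ∂(Measure.pi fun _ => μ)) := by
        -- The n + 1 choices of the entry carrying the logarithm turn 1/(n + 1)! into 1/n!.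
        have h1 : ((n + 1).factorial : ENNReal)⁻¹ * ((n + 1 : ℕ) : ENNReal) =
            (n.factorial : ENNReal)⁻¹ := by
          rw [Nat.factorial_succ, Nat.cast_mul, ENNReal.mul_inv (by simp) (by simp), mul_right_comm,
            ENNReal.inv_mul_cancel (by simp) (by simp), one_mul]
        rw [Finset.sum_const, Finset.card_univ, Fintype.card_fin, nsmul_eq_mul, ← mul_assoc, h1]
        ring
    _ = _ := rfl

/-- Entries of a tuple with product at most x lie in [1, x]; truncating the weight there and then
dropping the constraint on the product leaves a full exponential. -/
theorem setLIntegral_prod_div_le [SigmaFinite μ] (hμ : ∀ᵐ u ∂μ, 1 ≤ u) (hf : Measurable f)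
    (x : ℝ) (hfin : ∫⁻ u in Icc 1 x, f u * ENNReal.ofReal u⁻¹ ∂μ ≠ ⊤) :
    ∫⁻ c in {c | tupleProd c ≤ x}, (∏ i, f (c.2 i)) * ENNReal.ofReal (tupleProd c)⁻¹
        ∂tupleMeasure μ ≤
      ENNReal.ofReal (Real.exp (∫⁻ u in Icc 1 x, f u * ENNReal.ofReal u⁻¹ ∂μ).toReal) := by
  have hm : Measurable fun u => f u * ENNReal.ofReal u⁻¹ := by fun_prop
  rw [← tsum_inv_factorial_mul_pow hfin, ← lintegral_indicator measurableSet_Icc,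
    ← lintegral_prod_tupleMeasure (hm.indicator measurableSet_Icc)]
  refine (setLIntegral_mono_ae (measurable_prod_tuples (hm.indicator measurableSet_Icc)).aemeasurable
    ?_).trans (setLIntegral_le_lintegral _ _)
  filter_upwards [ae_tupleMeasure hμ] with c hc hX
  have h1 : ∀ i, c.2 i ∈ Icc 1 x := fun i => ⟨hc i, (single_le_prod_real hc i).trans hX⟩
  simp_rw [fun i => indicator_of_mem (h1 i) (fun u => f u * ENNReal.ofReal u⁻¹)]
  rw [Finset.prod_mul_distrib, tupleProd, ← Finset.prod_inv_distrib,
    ENNReal.ofReal_prod_of_nonneg fun i _ => inv_nonneg.2 (zero_le_one.trans (hc i))]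

/-- For 1 ≤ u ≤ x both 1 and log x are at most log u + x/u, because log(x/u) ≤ x/u. The two terms
contribute K and 1 to the factor K + 1. -/
theorem setLIntegral_prod_mul_log_le [SigmaFinite μ] (hμ : ∀ᵐ u ∂μ, 1 ≤ u) (hf : Measurable f)
    {K : ℝ} (hK0 : 0 ≤ K) (hK : ∀ x : ℝ, 1 ≤ x →
      ∫⁻ u in {u | u ≤ x}, f u * ENNReal.ofReal (Real.log u) ∂μ ≤ ENNReal.ofReal (K * x))
    {x : ℝ} (hx : 1 ≤ x) (hfin : ∫⁻ u in Icc 1 x, f u * ENNReal.ofReal u⁻¹ ∂μ ≠ ⊤) :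
    (∫⁻ c in {c | tupleProd c ≤ x}, ∏ i, f (c.2 i) ∂tupleMeasure μ) *
      ENNReal.ofReal (max 1 (Real.log x)) ≤ ENNReal.ofReal ((K + 1) * x *
        Real.exp (∫⁻ u in Icc 1 x, f u * ENNReal.ofReal u⁻¹ ∂μ).toReal) := by
  have hset := measurableSet_tupleProd_le x
  have hE := setLIntegral_prod_div_le hμ hf x hfin
  have hm1 : Measurable fun c : Tuples =>
      (∏ i, f (c.2 i)) * ENNReal.ofReal (Real.log (tupleProd c)) :=
    (measurable_prod_tuples hf).mul (Real.measurable_log.comp measurable_tupleProd).ennreal_ofReal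
  have hm2 : Measurable fun c : Tuples => (∏ i, f (c.2 i)) * ENNReal.ofReal (tupleProd c)⁻¹ :=
    (measurable_prod_tuples hf).mul measurable_tupleProd.inv.ennreal_ofReal
  rw [← lintegral_mul_const _ (measurable_prod_tuples hf)]
  calc _ ≤ ∫⁻ c in {c | tupleProd c ≤ x},
        ((∏ i, f (c.2 i)) * ENNReal.ofReal (Real.log (tupleProd c)) +
        ENNReal.ofReal x * ((∏ i, f (c.2 i)) * ENNReal.ofReal (tupleProd c)⁻¹))
        ∂tupleMeasure μ := by
        refine setLIntegral_mono_ae (hm1.add (hm2.const_mul _)).aemeasurable ?_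
        filter_upwards [ae_one_le_tupleProd hμ] with c hc hX
        have hX : tupleProd c ≤ x := hX
        have hp : 0 < tupleProd c := by linarith
        rw [mul_left_comm, ← ENNReal.ofReal_mul (by linarith), ← mul_add,
          ← ENNReal.ofReal_add (Real.log_nonneg hc) (by positivity)]
        refine mul_le_mul_right (ENNReal.ofReal_le_ofReal (max_le ?_ ?_)) _
        · have : 1 ≤ x * (tupleProd c)⁻¹ := by
            rw [← div_eq_mul_inv, one_le_div hp]; exact hX
          linarith [Real.log_nonneg hc]
        · have : x = tupleProd c * (x * (tupleProd c)⁻¹) := by field_simp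
          conv_lhs => rw [this]
          rw [Real.log_mul hp.ne' (by positivity)]
          linarith [Real.log_le_self (show 0 ≤ x * (tupleProd c)⁻¹ by positivity)]
    _ ≤ ENNReal.ofReal (K * x) * ENNReal.ofReal (Real.exp
          (∫⁻ u in Icc 1 x, f u * ENNReal.ofReal u⁻¹ ∂μ).toReal) +
        ENNReal.ofReal x * ENNReal.ofReal (Real.exp
          (∫⁻ u in Icc 1 x, f u * ENNReal.ofReal u⁻¹ ∂μ).toReal) := by
        rw [lintegral_add_left hm1, lintegral_const_mul _ hm2]
        gcongr
        exact (setLIntegral_mul_log_le hμ hf hK hx).trans (by gcongr)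
    _ = _ := by
        rw [← ENNReal.ofReal_mul (by positivity), ← ENNReal.ofReal_mul (by linarith),
          ← ENNReal.ofReal_add (by positivity) (by positivity)]
        congr 1
        ring

end SummatoryBound

/-! ### Splitting the exponent. -/

section SetIntegral

variable {μ : Measure ℝ} {g : ℝ → ℂ}

theorem integrableOn_norm_div (hg : Measurable g) {x : ℝ} (hi : IntegrableOn g (Icc 1 x) μ) :
    IntegrableOn (fun u => ‖g u‖ / u) (Icc 1 x) μ := by
  have hm : Measurable fun u : ℝ => ‖g u‖ / u := by fun_prop
  refine Integrable.mono' hi.norm hm.aestronglyMeasurable ?_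
  filter_upwards [ae_restrict_mem measurableSet_Icc] with u hu
  rw [Real.norm_of_nonneg (div_nonneg (norm_nonneg _) (by linarith [hu.1]))]
  exact div_le_self (norm_nonneg _) hu.1

variable [IsLocallyFiniteMeasure μ]

theorem integrableOn_inv_Icc (x : ℝ) : IntegrableOn (fun u : ℝ => u⁻¹) (Icc 1 x) μ :=
  ContinuousOn.integrableOn_compact isCompact_Icc
    (continuousOn_inv₀.mono fun u hu => by
      have := hu.1
      simp only [mem_compl_iff, mem_singleton_iff]
      linarith)

theorem setIntegral_norm_sub_one_div (hg : Measurable g) {x : ℝ}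
    (hi : IntegrableOn g (Icc 1 x) μ) :
    ∫ u in Icc 1 x, (‖g u‖ - 1) / u ∂μ =
      ∫ u in Icc 1 x, ‖g u‖ / u ∂μ - ∫ u in Icc 1 x, u⁻¹ ∂μ := by
  rw [← integral_sub (integrableOn_norm_div hg hi) (integrableOn_inv_Icc x)]
  simp_rw [sub_div, one_div]

end SetIntegral

/-! ### Absolute convergence to the right of 1, and the majorant. -/

section Tail

variable {μ : Measure ℝ} {g : ℝ → ℂ} {K : ℝ}

/-- Expanding u^{-σ} in this way reduces partial summation to Tonelli's theorem. -/
theorem ofReal_rpow_neg_eq_lintegral {u : ℝ} (hu : 1 ≤ u) {σ : ℝ} (hσ : 0 < σ) :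
    ENNReal.ofReal (u ^ (-σ)) = ENNReal.ofReal σ * ∫⁻ y in Ioi (0 : ℝ),
      {y : ℝ | u ≤ Real.exp y}.indicator (fun y => ENNReal.ofReal (Real.exp (-σ * y))) y := by
  have hm : MeasurableSet {y : ℝ | u ≤ Real.exp y} :=
    measurableSet_le measurable_const (by fun_prop)
  have hi : IntegrableOn (fun y : ℝ => {y : ℝ | u ≤ Real.exp y}.indicator
      (fun y : ℝ => Real.exp (-σ * y)) y) (Ioi 0) :=
    Integrable.indicator (exp_neg_integrableOn_Ioi 0 hσ) hm
  have h := integral_indicator_norm_exp hu hσ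
  have h1 : u ^ (-σ) = σ * ∫ y in Ioi (0 : ℝ), {y : ℝ | u ≤ Real.exp y}.indicator
      (fun y : ℝ => Real.exp (-σ * y)) y := by rw [h]; field_simp
  rw [h1, ENNReal.ofReal_mul hσ.le, ofReal_integral_eq_lintegral_ofReal hi
    (.of_forall fun y => indicator_nonneg (fun _ _ => (Real.exp_pos _).le) y)]
  congr 2
  ext y
  by_cases hy : u ≤ Real.exp y <;> simp [hy]

/-- Partial summation for a weight whose mass on `[1, x]` is at most `K x`. -/
theorem lintegral_mul_rpow_neg_le [SFinite μ] (hμ : ∀ᵐ u ∂μ, 1 ≤ u) {w : ℝ → ENNReal}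
    (hw : Measurable w) (hK0 : 0 ≤ K)
    (hK : ∀ x : ℝ, 1 ≤ x → ∫⁻ u in {u | u ≤ x}, w u ∂μ ≤ ENNReal.ofReal (K * x))
    {σ : ℝ} (hσ : 1 < σ) :
    ∫⁻ u, w u * ENNReal.ofReal (u ^ (-σ)) ∂μ ≤ ENNReal.ofReal (K * σ / (σ - 1)) := by
  have hσ0 : 0 < σ := by linarith
  have hset : MeasurableSet {z : ℝ × ℝ | z.1 ≤ Real.exp z.2} :=
    measurableSet_le (by fun_prop) (by fun_prop)
  set k : ℝ → ℝ → ENNReal := fun u y => w u *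
    {y : ℝ | u ≤ Real.exp y}.indicator (fun y => ENNReal.ofReal (Real.exp (-σ * y))) y with hk
  have hkm : Measurable (Function.uncurry k) := by
    have : Measurable ({z : ℝ × ℝ | z.1 ≤ Real.exp z.2}.indicator
      (fun z : ℝ × ℝ => ENNReal.ofReal (Real.exp (-σ * z.2)))) :=
      Measurable.indicator (by fun_prop) hset
    exact (hw.comp measurable_fst).mul this
  have hky : ∀ u, Measurable
      ({y : ℝ | u ≤ Real.exp y}.indicator fun y => ENNReal.ofReal (Real.exp (-σ * y))) :=
    fun u => Measurable.indicator (by fun_prop)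
      (measurableSet_le measurable_const (by fun_prop))
  calc _ = ∫⁻ u, ENNReal.ofReal σ * (∫⁻ y in Ioi (0 : ℝ), k u y) ∂μ := by
        refine lintegral_congr_ae ?_
        filter_upwards [hμ] with u hu
        rw [ofReal_rpow_neg_eq_lintegral hu hσ0, lintegral_const_mul _ (hky u)]
        ring
    _ = ENNReal.ofReal σ * ∫⁻ y in Ioi (0 : ℝ), ∫⁻ u, k u y ∂μ := by
        have hin : Measurable fun u => ∫⁻ y in Ioi (0 : ℝ), k u y := hkm.lintegral_prod_right'
        rw [lintegral_const_mul _ hin,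
          lintegral_lintegral_swap hkm.aemeasurable]
    _ ≤ ENNReal.ofReal σ * ∫⁻ y in Ioi (0 : ℝ), ENNReal.ofReal (K * Real.exp (-(σ - 1) * y)) := by
        refine mul_le_mul_right (setLIntegral_mono (by fun_prop) fun y hy => ?_) _
        have hms : MeasurableSet {u : ℝ | u ≤ Real.exp y} := measurableSet_Iic
        have h1 : ∀ u, k u y = ENNReal.ofReal (Real.exp (-σ * y)) *
            {u : ℝ | u ≤ Real.exp y}.indicator w u := fun u => by
          by_cases hu : u ≤ Real.exp y <;> simp [hk, hu, mul_comm]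
        simp_rw [h1]
        rw [lintegral_const_mul _ (hw.indicator hms), lintegral_indicator hms]
        refine (mul_le_mul_right (hK _ (Real.one_le_exp (le_of_lt hy))) _).trans_eq ?_
        rw [← ENNReal.ofReal_mul (Real.exp_pos _).le, mul_left_comm, ← Real.exp_add]
        ring_nf
    _ = _ := by
        rw [← ofReal_integral_eq_lintegral_ofReal
          ((exp_neg_integrableOn_Ioi 0 (by linarith : 0 < σ - 1)).const_mul K)
          (.of_forall fun y => by positivity), ← ENNReal.ofReal_mul hσ0.le, integral_const_mul,
          integral_exp_mul_Ioi (by linarith)]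
        congr 1
        rw [mul_zero, Real.exp_zero, neg_div_neg_eq]
        ring

section WithBound

variable [SFinite μ] (hμ : ∀ᵐ u ∂μ, 1 ≤ u) (hg : Measurable g) (hK0 : 0 ≤ K)
  (hK : ∀ x : ℝ, 1 ≤ x →
    ∫⁻ u in {u | u ≤ x}, ‖g u‖ₑ * ENNReal.ofReal (Real.log u) ∂μ ≤ ENNReal.ofReal (K * x))

include hμ hg hK0 hK

theorem integrable_norm_mul_log_mul_rpow {σ : ℝ} (hσ : 1 < σ) :
    Integrable (fun u => ‖g u‖ * Real.log u * u ^ (-σ)) μ ∧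
      ∫ u, ‖g u‖ * Real.log u * u ^ (-σ) ∂μ ≤ K * σ / (σ - 1) := by
  have h := lintegral_mul_rpow_neg_le hμ (by fun_prop) hK0 hK hσ
  have h0 : 0 ≤ᵐ[μ] fun u => ‖g u‖ * Real.log u * u ^ (-σ) := by
    filter_upwards [hμ] with u hu
    have := Real.log_nonneg hu
    exact mul_nonneg (by positivity) (Real.rpow_nonneg (by linarith) _)
  have hm : Measurable fun u => ‖g u‖ * Real.log u * u ^ (-σ) := by fun_prop
  have e : ∫⁻ u, ENNReal.ofReal (‖g u‖ * Real.log u * u ^ (-σ)) ∂μ =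
      ∫⁻ u, ‖g u‖ₑ * ENNReal.ofReal (Real.log u) * ENNReal.ofReal (u ^ (-σ)) ∂μ := by
    refine lintegral_congr_ae ?_
    filter_upwards [hμ] with u hu
    have := Real.log_nonneg hu
    rw [ENNReal.ofReal_mul (by positivity), ENNReal.ofReal_mul (by positivity),
      ofReal_norm]
  constructor
  · refine ⟨hm.aestronglyMeasurable, ?_⟩
    rw [hasFiniteIntegral_iff_ofReal h0, e]
    exact h.trans_lt ENNReal.ofReal_lt_top
  · rw [integral_eq_lintegral_of_nonneg_ae h0 hm.aestronglyMeasurable, e]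
    exact ENNReal.toReal_le_of_le_ofReal
      (div_nonneg (mul_nonneg hK0 (by linarith)) (by linarith)) h

/-- The bound with log u gives no control near u = 1, so local integrability is used on [1, e];
beyond e the logarithm is at least 1. -/
theorem integrable_norm_mul_rpow (hloc : ∀ X, IntegrableOn g (Icc 1 X) μ) {σ : ℝ} (hσ : 1 < σ) :
    Integrable (fun u => ‖g u‖ * u ^ (-σ)) μ := by
  refine Integrable.mono' (((hloc (Real.exp 1)).integrable_indicator measurableSet_Icc).norm.add
    (integrable_norm_mul_log_mul_rpow hμ hg hK0 hK hσ).1) (by fun_prop) ?_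
  filter_upwards [hμ] with u hu
  have h1 : 0 ≤ u ^ (-σ) := Real.rpow_nonneg (by linarith) _
  have h2 := Real.log_nonneg hu
  rw [Real.norm_of_nonneg (by positivity), Pi.add_apply]
  by_cases hle : u ≤ Real.exp 1
  · rw [indicator_of_mem (show u ∈ Icc 1 (Real.exp 1) from ⟨hu, hle⟩)]
    have : u ^ (-σ) ≤ 1 := Real.rpow_le_one_of_one_le_of_nonpos hu (by linarith)
    have h3 : ‖g u‖ * u ^ (-σ) ≤ ‖g u‖ := mul_le_of_le_one_right (norm_nonneg _) this
    have h4 : 0 ≤ ‖g u‖ * Real.log u * u ^ (-σ) := by positivity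
    linarith
  · have h3 : 1 ≤ Real.log u := by
      rw [Real.le_log_iff_exp_le (by linarith)]
      exact (not_le.1 hle).le
    have h4 : ‖g u‖ * u ^ (-σ) ≤ ‖g u‖ * Real.log u * u ^ (-σ) := by
      gcongr
      exact le_mul_of_one_le_right (norm_nonneg _) h3
    exact h4.trans (le_add_of_nonneg_left (norm_nonneg _))

theorem hasDerivAt_integral_mul_cpow (hloc : ∀ X, IntegrableOn g (Icc 1 X) μ) {s : ℂ}
    (hs : 1 < s.re) :
    HasDerivAt (fun s : ℂ => ∫ u, g u * (u : ℂ) ^ (-s) ∂μ)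
      (∫ u, -(g u * Real.log u * (u : ℂ) ^ (-s)) ∂μ) s := by
  -- The midpoint between 1 and Re s: one integrable majorant then serves a whole neighbourhood of
  -- s.
  set σ := (1 + s.re) / 2 with hσ
  have hopen : IsOpen {z : ℂ | σ < z.re} := isOpen_lt continuous_const Complex.continuous_re
  have hmem : {z : ℂ | σ < z.re} ∈ nhds s := hopen.mem_nhds (by
    show σ < s.re
    linarith)
  refine (hasDerivAt_integral_of_dominated_loc_of_deriv_le hmem
    (F := fun s u => g u * (u : ℂ) ^ (-s)) (F' := fun s u => -(g u * Real.log u * (u : ℂ) ^ (-s)))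
    (bound := fun u => ‖g u‖ * Real.log u * u ^ (-σ)) (.of_forall fun z => by fun_prop)
    (integrable_mul_cpow hμ hg (integrable_norm_mul_rpow hμ hg hK0 hK hloc hs)) (by fun_prop) ?_
    (integrable_norm_mul_log_mul_rpow hμ hg hK0 hK (by linarith)).1 ?_).2
  · filter_upwards [hμ] with u hu z hz
    have hz : σ < z.re := hz
    have := Real.log_nonneg hu
    rw [norm_neg, norm_mul, norm_mul, norm_ofReal_cpow_neg (by linarith), Complex.norm_real,
      Real.norm_of_nonneg this]
    exact mul_le_mul_of_nonneg_left (Real.rpow_le_rpow_of_exponent_le hu (by linarith))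
      (by positivity)
  · filter_upwards [hμ] with u hu z _
    have hu0 : (u : ℂ) ≠ 0 := by exact_mod_cast (show u ≠ 0 by linarith)
    have h := ((hasDerivAt_id z).neg.const_cpow (c := (u : ℂ)) (Or.inl hu0)).const_mul (g u)
    convert! h using 1
    rw [← Complex.ofReal_log (by linarith)]
    simp only [id, Pi.neg_apply]
    ring

/-- Rankin's trick with exponent 1 + 1/y: for u ≤ e^y, u⁻¹ ≤ e · u^{-(1 + 1/y)}, and for u > e^L, 1
≤ (log u)/L. The parameter L makes the slope eK/L in y as small as desired. -/
theorem setIntegral_norm_div_le (hloc : ∀ X, IntegrableOn g (Icc 1 X) μ) {L y : ℝ} (hL : 0 < L)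
    (hy : 0 < y) :
    ∫ u in Icc 1 (Real.exp y), ‖g u‖ / u ∂μ ≤
      ∫ u in Icc 1 (Real.exp L), ‖g u‖ ∂μ + Real.exp 1 / L * (K * (y + 1)) := by
  have hσ : 1 < 1 + y⁻¹ := by linarith [inv_pos.2 hy]
  obtain ⟨hi, hb⟩ := integrable_norm_mul_log_mul_rpow hμ hg hK0 hK hσ
  have hi1 := (integrable_indicator_iff (f := fun u => ‖g u‖) measurableSet_Icc).2
    (hloc (Real.exp L)).norm
  have hi2 := (hi.const_mul (Real.exp 1 / L))
  have hnn : 0 ≤ᵐ[μ] fun u => (Icc 1 (Real.exp L)).indicator (fun u => ‖g u‖) u +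
      Real.exp 1 / L * (‖g u‖ * Real.log u * u ^ (-(1 + y⁻¹))) := by
    filter_upwards [hμ] with u hu
    have h1 := Real.log_nonneg hu
    have h2 : 0 ≤ u ^ (-(1 + y⁻¹)) := Real.rpow_nonneg (by linarith) _
    exact add_nonneg (indicator_nonneg (fun _ _ => norm_nonneg _) _) (by positivity)
  have key : ∀ u ∈ Icc 1 (Real.exp y), ‖g u‖ / u ≤
      (Icc 1 (Real.exp L)).indicator (fun u => ‖g u‖) u +
      Real.exp 1 / L * (‖g u‖ * Real.log u * u ^ (-(1 + y⁻¹))) := by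
    intro u ⟨hu1, huy⟩
    have hu0 : 0 < u := by linarith
    have h1 := Real.log_nonneg hu1
    have h2 : 0 ≤ u ^ (-(1 + y⁻¹)) := Real.rpow_nonneg hu0.le _
    have h3 : 0 ≤ Real.exp 1 / L * (‖g u‖ * Real.log u * u ^ (-(1 + y⁻¹))) := by positivity
    by_cases hle : u ≤ Real.exp L
    · rw [indicator_of_mem (show u ∈ Icc 1 (Real.exp L) from ⟨hu1, hle⟩)]
      linarith [div_le_self (norm_nonneg (g u)) hu1]
    · rw [indicator_of_notMem (fun h => hle h.2), zero_add]
      have h4 : L ≤ Real.log u := by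
        rw [Real.le_log_iff_exp_le hu0]; exact (not_le.1 hle).le
      have h5 : u⁻¹ ≤ Real.exp 1 * u ^ (-(1 + y⁻¹)) := by
        rw [Real.rpow_def_of_pos hu0, ← Real.exp_add, ← Real.exp_log (inv_pos.2 hu0),
          Real.log_inv, Real.exp_le_exp]
        have h6 : Real.log u * y⁻¹ ≤ 1 := by
          rw [← div_eq_mul_inv, div_le_one hy, Real.log_le_iff_le_exp hu0]
          exact huy
        linarith
      calc ‖g u‖ / u = ‖g u‖ * 1 * u⁻¹ := by rw [mul_one, div_eq_mul_inv]
        _ ≤ ‖g u‖ * (Real.log u / L) * (Real.exp 1 * u ^ (-(1 + y⁻¹))) := by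
          gcongr
          exact (one_le_div hL).2 h4
        _ = _ := by ring
  calc _ ≤ ∫ u in Icc 1 (Real.exp y), ((Icc 1 (Real.exp L)).indicator (fun u => ‖g u‖) u +
          Real.exp 1 / L * (‖g u‖ * Real.log u * u ^ (-(1 + y⁻¹)))) ∂μ := by
        refine setIntegral_mono_on ?_ (hi1.add hi2).integrableOn measurableSet_Icc key
        have hdm : Measurable fun u : ℝ => ‖g u‖ / u := by fun_prop
        refine Integrable.mono' (hi1.add hi2).integrableOn hdm.aestronglyMeasurable ?_
        filter_upwards [ae_restrict_mem measurableSet_Icc] with u hu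
        rw [Real.norm_of_nonneg (div_nonneg (norm_nonneg _) (by linarith [hu.1]))]
        exact key u hu
    _ ≤ ∫ u, ((Icc 1 (Real.exp L)).indicator (fun u => ‖g u‖) u +
          Real.exp 1 / L * (‖g u‖ * Real.log u * u ^ (-(1 + y⁻¹)))) ∂μ :=
        setIntegral_le_integral (hi1.add hi2) hnn
    _ ≤ _ := by
        rw [integral_add hi1 hi2, integral_indicator measurableSet_Icc, integral_const_mul]
        have h1 : K * (1 + y⁻¹) / (1 + y⁻¹ - 1) = K * (y + 1) := by
          field_simp
          ring
        rw [h1] at hb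
        gcongr

/-- The majorant in the mean square bound is integrable. -/
theorem integrableOn_exp_mul_exp_setIntegral [IsLocallyFiniteMeasure μ]
    (hloc : ∀ X, IntegrableOn g (Icc 1 X) μ) {δ : ℝ} (hδ : 0 < δ) :
    IntegrableOn (fun y : ℝ => Real.exp (-2 * y * δ) *
      Real.exp (2 * ∫ u in Icc 1 (Real.exp y), (‖g u‖ - 1) / u ∂μ)) (Ioi 0) := by
  have hmeas : Measurable fun y : ℝ => ∫ u in Icc 1 (Real.exp y), (‖g u‖ - 1) / u ∂μ := by
    have hset : MeasurableSet {z : ℝ × ℝ | z.2 ∈ Icc 1 (Real.exp z.1)} :=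
      (measurableSet_le measurable_const measurable_snd).inter
        (measurableSet_le measurable_snd (by fun_prop))
    have h1 : StronglyMeasurable ({z : ℝ × ℝ | z.2 ∈ Icc 1 (Real.exp z.1)}.indicator
        fun z : ℝ × ℝ => (‖g z.2‖ - 1) / z.2) :=
      (Measurable.indicator (by fun_prop) hset).stronglyMeasurable
    have h2 := (h1.integral_prod_right' (ν := μ)).measurable
    convert! h2 using 2 with y
    rw [← integral_indicator measurableSet_Icc]
    rfl
  -- This L makes the slope at most δ/2, so the second exponent is at most 2A + δ(y + 1) and e^{-δy}
  -- survives; the summand 1 keeps L positive when K = 0.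
  set L : ℝ := 2 * Real.exp 1 * K / δ + 1 with hL
  have hL0 : 0 < L := by positivity
  set A : ℝ := ∫ u in Icc 1 (Real.exp L), ‖g u‖ ∂μ with hA
  have hLδ : Real.exp 1 / L * K ≤ δ / 2 := by
    have h1 : 2 * Real.exp 1 * K / δ ≤ L := by linarith
    rw [div_le_iff₀ hδ] at h1
    rw [div_mul_eq_mul_div, div_le_iff₀ hL0]
    linarith
  refine Integrable.mono' ((exp_neg_integrableOn_Ioi 0 hδ).const_mul (Real.exp (2 * A + δ)))
    (by fun_prop) ?_
  filter_upwards [ae_restrict_mem measurableSet_Ioi] with y hy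
  have hy : 0 < y := hy
  rw [Real.norm_of_nonneg (by positivity), ← Real.exp_add, ← Real.exp_add, Real.exp_le_exp]
  have hinv : 0 ≤ ∫ u in Icc 1 (Real.exp y), u⁻¹ ∂μ :=
    setIntegral_nonneg measurableSet_Icc fun u hu => inv_nonneg.2 (by linarith [hu.1])
  rw [setIntegral_norm_sub_one_div hg (hloc _)]
  have hb := setIntegral_norm_div_le hμ hg hK0 hK hloc hL0 hy
  have h2 : Real.exp 1 / L * (K * (y + 1)) ≤ δ / 2 * (y + 1) := by
    rw [← mul_assoc]
    gcongr
  linarith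

end WithBound

end Tail

/-! ### The pointwise bound for the summatory function. -/

section LocallyFinite

variable {μ : Measure ℝ} {g : ℝ → ℂ} {K : ℝ}

theorem setOf_le_ae_eq_Icc (hμ : ∀ᵐ u ∂μ, 1 ≤ u) (x : ℝ) : {u | u ≤ x} =ᵐ[μ] Icc 1 x := by
  filter_upwards [hμ] with u hu
  exact propext ⟨fun h => ⟨hu, h⟩, fun h => h.2⟩

theorem integrableOn_norm_mul_log (hg : Measurable g) {x : ℝ} (hi : IntegrableOn g (Icc 1 x) μ) :
    IntegrableOn (fun u => ‖g u‖ * Real.log u) (Icc 1 x) μ := by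
  have hm : Measurable fun u => ‖g u‖ * Real.log u := by fun_prop
  refine Integrable.mono' (hi.norm.mul_const (Real.log x)) hm.aestronglyMeasurable ?_
  filter_upwards [ae_restrict_mem measurableSet_Icc] with u hu
  have h0 : 0 < u := by linarith [hu.1]
  have h1 := Real.log_nonneg hu.1
  rw [Real.norm_of_nonneg (by positivity)]
  gcongr
  exact hu.2

theorem setLIntegral_norm_mul_log_le (hμ : ∀ᵐ u ∂μ, 1 ≤ u) (hg : Measurable g) {x : ℝ}
    (hi : IntegrableOn g (Icc 1 x) μ)
    (hK : ∫ u in Icc 1 x, ‖g u‖ * Real.log u ∂μ ≤ K * x) :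
    ∫⁻ u in {u | u ≤ x}, ‖g u‖ₑ * ENNReal.ofReal (Real.log u) ∂μ ≤ ENNReal.ofReal (K * x) := by
  have h0 : 0 ≤ᵐ[μ.restrict (Icc 1 x)] fun u => ‖g u‖ * Real.log u := by
    filter_upwards [ae_restrict_mem measurableSet_Icc] with u hu
    exact mul_nonneg (norm_nonneg _) (Real.log_nonneg hu.1)
  rw [setLIntegral_congr (setOf_le_ae_eq_Icc hμ x)]
  refine le_trans (le_of_eq ?_) (ENNReal.ofReal_le_ofReal hK)
  rw [ofReal_integral_eq_lintegral_ofReal (integrableOn_norm_mul_log hg hi) h0]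
  refine lintegral_congr fun u => ?_
  rw [ENNReal.ofReal_mul (norm_nonneg _), ofReal_norm]

variable [IsLocallyFiniteMeasure μ]

theorem exp_setIntegral_inv_le
    (hM : ∀ x : ℝ, 2 ≤ x → ∫ u in Icc 1 x, u⁻¹ ∂μ ≤ Real.log (Real.log x) + K)
    {x : ℝ} : Real.exp (∫ u in Icc 1 x, u⁻¹ ∂μ) ≤ Real.exp K * max 1 (Real.log x) := by
  have key : ∀ y : ℝ, 2 ≤ y → Real.exp (∫ u in Icc 1 y, u⁻¹ ∂μ) ≤ Real.exp K * Real.log y :=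
    fun y hy => by
      have : 0 < Real.log y := Real.log_pos (by linarith)
      calc _ ≤ Real.exp (Real.log (Real.log y) + K) := Real.exp_le_exp.2 (hM y hy)
        _ = _ := by rw [Real.exp_add, Real.exp_log this, mul_comm]
  rcases le_total 2 x with h | h
  · exact (key x h).trans (by gcongr; exact le_max_right _ _)
  -- Below 2 monotonicity reduces to the value at 2, and log 2 ≤ 1 is absorbed by the maximum.
  · calc _ ≤ Real.exp (∫ u in Icc 1 2, u⁻¹ ∂μ) := by
          refine Real.exp_le_exp.2 (setIntegral_mono_set (integrableOn_inv_Icc 2) ?_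
            (Icc_subset_Icc_right h).eventuallyLE)
          filter_upwards [ae_restrict_mem measurableSet_Icc] with u hu
          exact inv_nonneg.2 (by linarith [hu.1])
      _ ≤ Real.exp K * Real.log 2 := key 2 le_rfl
      _ ≤ _ := by
        gcongr
        exact le_max_of_le_left (by linarith [Real.log_two_lt_d9])

/-- After passing to absolute values, the saved factor max(1, log x) is exchanged for exp(∫ u⁻¹ dμ)
at the cost of e^K. -/
theorem norm_setIntegral_prod_div_le (hμ : ∀ᵐ u ∂μ, 1 ≤ u) (hg : Measurable g) (hK0 : 0 ≤ K)
    (hloc : ∀ X, IntegrableOn g (Icc 1 X) μ)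
    (hM : ∀ x : ℝ, 2 ≤ x → ∫ u in Icc 1 x, u⁻¹ ∂μ ≤ Real.log (Real.log x) + K)
    (hK : ∀ x : ℝ, 1 ≤ x →
      ∫⁻ u in {u | u ≤ x}, ‖g u‖ₑ * ENNReal.ofReal (Real.log u) ∂μ ≤ ENNReal.ofReal (K * x))
    {x : ℝ} (hx : 1 ≤ x) :
    ‖∫ c in {c | tupleProd c ≤ x}, ∏ i, g (c.2 i) ∂tupleMeasure μ‖ / x ≤
      (K + 1) * Real.exp K * Real.exp (∫ u in Icc 1 x, (‖g u‖ - 1) / u ∂μ) := by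
  have hI : ∫⁻ u in Icc 1 x, ‖g u‖ₑ * ENNReal.ofReal u⁻¹ ∂μ =
      ENNReal.ofReal (∫ u in Icc 1 x, ‖g u‖ / u ∂μ) := by
    rw [ofReal_integral_eq_lintegral_ofReal (integrableOn_norm_div hg (hloc x))]
    · refine lintegral_congr fun u => ?_
      rw [div_eq_mul_inv, ENNReal.ofReal_mul (norm_nonneg _), ofReal_norm]
    · filter_upwards [ae_restrict_mem measurableSet_Icc] with u hu
      exact div_nonneg (norm_nonneg _) (by linarith [hu.1])
  have hI0 : 0 ≤ ∫ u in Icc 1 x, ‖g u‖ / u ∂μ :=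
    setIntegral_nonneg measurableSet_Icc fun u hu =>
      div_nonneg (norm_nonneg _) (by linarith [hu.1])
  have hF := setLIntegral_prod_mul_log_le hμ hg.enorm hK0 hK hx
    (by rw [hI]; exact ENNReal.ofReal_ne_top)
  rw [hI, ENNReal.toReal_ofReal hI0] at hF
  set m := max 1 (Real.log x) with hm
  have hm0 : 0 < m := zero_lt_one.trans_le (le_max_left _ _)
  set A := ∫ u in Icc 1 x, ‖g u‖ / u ∂μ
  set B := ∫ u in Icc 1 x, u⁻¹ ∂μ with hB
  have hnorm : ‖∫ c in {c | tupleProd c ≤ x}, ∏ i, g (c.2 i) ∂tupleMeasure μ‖ * m ≤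
      (K + 1) * x * Real.exp A := by
    rw [← ENNReal.ofReal_le_ofReal_iff (by positivity), ENNReal.ofReal_mul (norm_nonneg _),
      ofReal_norm]
    refine le_trans (mul_le_mul_left ((enorm_integral_le_lintegral_enorm _).trans_eq ?_) _) hF
    refine lintegral_congr fun c => ?_
    simp_rw [enorm_eq_nnnorm, nnnorm_prod, ENNReal.ofNNReal_finsetProd]
  have hBm : Real.exp B ≤ Real.exp K * m := exp_setIntegral_inv_le hM
  rw [setIntegral_norm_sub_one_div hg (hloc x), Real.exp_sub, div_le_iff₀ (by linarith)]
  rw [← le_div_iff₀ hm0] at hnorm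
  refine hnorm.trans ?_
  rw [div_le_iff₀ hm0]
  have h1 : 1 ≤ Real.exp K * m / Real.exp B := (one_le_div (Real.exp_pos _)).2 hBm
  calc _ ≤ (K + 1) * x * Real.exp A * (Real.exp K * m / Real.exp B) :=
        le_mul_of_one_le_right (by positivity) h1
    _ = _ := by ring

end LocallyFinite

/-! ### Mean squares on vertical lines. -/

section MeanSquare

variable {μ : Measure ℝ} {g : ℝ → ℂ} {K : ℝ} [IsLocallyFiniteMeasure μ]

theorem norm_sq_mul_exp (z : ℂ) (y σ : ℝ) :
    ‖z * Complex.exp (-(σ : ℂ) * y)‖ ^ 2 = ‖z‖ ^ 2 * Real.exp (-2 * y * σ) := by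
  rw [norm_mul, mul_pow, Complex.norm_exp, ← Real.exp_nat_mul]
  congr 2
  simp
  ring

theorem integral_norm_sq_exp_div_le (hμ : ∀ᵐ u ∂μ, 1 ≤ u) (hg : Measurable g) (hK0 : 0 ≤ K)
    (hloc : ∀ X, IntegrableOn g (Icc 1 X) μ)
    (hM : ∀ x : ℝ, 2 ≤ x → ∫ u in Icc 1 x, u⁻¹ ∂μ ≤ Real.log (Real.log x) + K)
    (hK : ∀ x : ℝ, 1 ≤ x →
      ∫⁻ u in {u | u ≤ x}, ‖g u‖ₑ * ENNReal.ofReal (Real.log u) ∂μ ≤ ENNReal.ofReal (K * x))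
    {σ : ℝ} (hσ : 1 < σ) :
    Integrable (fun t : ℝ => ‖Complex.exp (∫ u, g u * (u : ℂ) ^ (-(σ + t * Complex.I)) ∂μ) /
      (σ + t * Complex.I)‖ ^ 2) ∧
    ∫ t : ℝ, ‖Complex.exp (∫ u, g u * (u : ℂ) ^ (-(σ + t * Complex.I)) ∂μ) /
      (σ + t * Complex.I)‖ ^ 2 ≤ 2 * Real.pi * ((K + 1) * Real.exp K) ^ 2 *
        ∫ y in Ioi (0 : ℝ), Real.exp (-2 * y * (σ - 1)) *
          Real.exp (2 * ∫ u in Icc 1 (Real.exp y), (‖g u‖ - 1) / u ∂μ) := by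
  have hσ0 : 0 < σ := by linarith
  have hrpow := integrable_norm_mul_rpow hμ hg hK0 hK hloc hσ
  have hi : Integrable (fun c : Tuples => ‖∏ i, g (c.2 i)‖ * tupleProd c ^ (-σ))
      (tupleMeasure μ) := by
    refine (integrable_prod_mul_cpow hμ hg (s := σ) (by simpa using hrpow)).norm.congr ?_
    filter_upwards [ae_one_le_tupleProd hμ] with c hc
    rw [norm_mul, norm_ofReal_cpow_neg (by linarith), Complex.ofReal_re]
  have hh : AEStronglyMeasurable (fun c : Tuples => ∏ i, g (c.2 i)) (tupleMeasure μ) :=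
    (measurable_prod_tuples hg).aestronglyMeasurable
  have hmaj := (integrableOn_exp_mul_exp_setIntegral hμ hg hK0 hK hloc
    (show 0 < σ - 1 by linarith)).const_mul (((K + 1) * Real.exp K) ^ 2)
  have hle : ∀ y ∈ Ioi (0 : ℝ),
      ‖∫ c in {c | tupleProd c ≤ Real.exp y}, ∏ i, g (c.2 i) ∂tupleMeasure μ‖ ^ 2 *
        Real.exp (-2 * y * σ) ≤ ((K + 1) * Real.exp K) ^ 2 * (Real.exp (-2 * y * (σ - 1)) *
          Real.exp (2 * ∫ u in Icc 1 (Real.exp y), (‖g u‖ - 1) / u ∂μ)) := fun y hy => by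
    have h := norm_setIntegral_prod_div_le hμ hg hK0 hloc hM hK
      (Real.one_le_exp (le_of_lt hy))
    rw [div_le_iff₀ (Real.exp_pos _)] at h
    calc _ ≤ ((K + 1) * Real.exp K * Real.exp (∫ u in Icc 1 (Real.exp y), (‖g u‖ - 1) / u ∂μ) *
          Real.exp y) ^ 2 * Real.exp (-2 * y * σ) := by gcongr
      _ = ((K + 1) * Real.exp K) ^ 2 * ((Real.exp y ^ 2 * Real.exp (-2 * y * σ)) *
          Real.exp (∫ u in Icc 1 (Real.exp y), (‖g u‖ - 1) / u ∂μ) ^ 2) := by ring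
      _ = _ := by
        rw [← Real.exp_nat_mul, ← Real.exp_nat_mul, ← Real.exp_add, Nat.cast_ofNat]
        congr 3
        ring_nf
  have h2 : IntegrableOn (fun y : ℝ =>
      ‖∫ c in {c | tupleProd c ≤ Real.exp y}, ∏ i, g (c.2 i) ∂tupleMeasure μ‖ ^ 2 *
        Real.exp (-2 * y * σ)) (Ioi 0) := by
    refine Integrable.mono' hmaj ?_ ?_
    · have := (integral_summatory_mul_exp hh measurable_tupleProd (ae_one_le_tupleProd hμ)
        (s := σ) (by simpa) (by simpa using hi)).1.1.norm.pow 2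
      refine this.congr (.of_forall fun y => ?_)
      exact norm_sq_mul_exp _ y σ
    · filter_upwards [ae_restrict_mem measurableSet_Ioi] with y hy
      rw [Real.norm_of_nonneg (by positivity)]
      exact hle y hy
  obtain ⟨h3, h4⟩ := integral_norm_sq_mellin_div hh measurable_tupleProd
    (ae_one_le_tupleProd hμ) hσ0 hi h2
  have hexp : ∀ t : ℝ, ∫ c, (∏ i, g (c.2 i)) * (tupleProd c : ℂ) ^ (-(σ + t * Complex.I))
      ∂tupleMeasure μ = Complex.exp (∫ u, g u * (u : ℂ) ^ (-(σ + t * Complex.I)) ∂μ) := fun t =>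
    integral_prod_mul_cpow hμ hg (by simpa using hrpow)
  simp_rw [hexp] at h3 h4
  refine ⟨h3, ?_⟩
  rw [h4, mul_assoc (2 * Real.pi)]
  refine mul_le_mul_of_nonneg_left ?_ (by positivity)
  rw [← integral_const_mul]
  exact setIntegral_mono_on h2 hmaj measurableSet_Ioi hle

/-- Plancherel is applied on μ itself rather than on tuples; the constant is 2πK² ∫_0^∞ e^{-2(σ-1)y}
dy. -/
theorem integral_norm_sq_integral_log_div_le (hμ : ∀ᵐ u ∂μ, 1 ≤ u) (hg : Measurable g)
    (hK0 : 0 ≤ K)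
    (hK : ∀ x : ℝ, 1 ≤ x →
      ∫⁻ u in {u | u ≤ x}, ‖g u‖ₑ * ENNReal.ofReal (Real.log u) ∂μ ≤ ENNReal.ofReal (K * x))
    {σ : ℝ} (hσ : 1 < σ) :
    Integrable (fun t : ℝ => ‖(∫ u, -(g u * Real.log u * (u : ℂ) ^ (-(σ + t * Complex.I))) ∂μ) /
      (σ + t * Complex.I)‖ ^ 2) ∧
    ∫ t : ℝ, ‖(∫ u, -(g u * Real.log u * (u : ℂ) ^ (-(σ + t * Complex.I))) ∂μ) /
      (σ + t * Complex.I)‖ ^ 2 ≤ Real.pi * K ^ 2 / (σ - 1) := by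
  have hσ0 : 0 < σ := by linarith
  have hσ1 : 0 < σ - 1 := by linarith
  set h : ℝ → ℂ := fun u => -(g u * Real.log u) with hdef
  have hn : ∀ᵐ u ∂μ, ‖h u‖ = ‖g u‖ * Real.log u := by
    filter_upwards [hμ] with u hu
    rw [hdef, norm_neg, norm_mul, Complex.norm_real, Real.norm_of_nonneg (Real.log_nonneg hu)]
  have hh : AEStronglyMeasurable h μ := by
    have : Measurable h := by fun_prop
    exact this.aestronglyMeasurable
  have hi : Integrable (fun u => ‖h u‖ * u ^ (-σ)) μ := by
    refine (integrable_norm_mul_log_mul_rpow hμ hg hK0 hK hσ).1.congr ?_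
    filter_upwards [hn] with u hu
    rw [hu]
  have hle : ∀ y ∈ Ioi (0 : ℝ), ‖∫ u in {u | u ≤ Real.exp y}, h u ∂μ‖ ^ 2 *
      Real.exp (-2 * y * σ) ≤ K ^ 2 * Real.exp (-(2 * (σ - 1)) * y) := fun y hy => by
    have h1 : ‖∫ u in {u | u ≤ Real.exp y}, h u ∂μ‖ ≤ K * Real.exp y := by
      rw [← ENNReal.ofReal_le_ofReal_iff (by positivity), ofReal_norm]
      refine (enorm_integral_le_lintegral_enorm _).trans
        (le_trans (le_of_eq ?_) (hK _ (Real.one_le_exp (le_of_lt hy))))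
      refine lintegral_congr_ae ?_
      filter_upwards [ae_restrict_of_ae hn] with u hu
      rw [← ofReal_norm, hu, ENNReal.ofReal_mul (norm_nonneg _), ofReal_norm]
    calc _ ≤ (K * Real.exp y) ^ 2 * Real.exp (-2 * y * σ) := by gcongr
      _ = _ := by
        rw [mul_pow, mul_assoc, ← Real.exp_nat_mul, ← Real.exp_add, Nat.cast_ofNat]
        ring_nf
  have hmaj : IntegrableOn (fun y : ℝ => K ^ 2 * Real.exp (-(2 * (σ - 1)) * y)) (Ioi 0) :=
    (exp_neg_integrableOn_Ioi 0 (by linarith)).const_mul _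
  have h2 : IntegrableOn (fun y : ℝ => ‖∫ u in {u | u ≤ Real.exp y}, h u ∂μ‖ ^ 2 *
      Real.exp (-2 * y * σ)) (Ioi 0) := by
    refine Integrable.mono' hmaj ?_ ?_
    · have := (integral_summatory_mul_exp hh measurable_id hμ
        (s := σ) (by simpa) (by simpa using hi)).1.1.norm.pow 2
      refine this.congr (.of_forall fun y => ?_)
      exact norm_sq_mul_exp _ y σ
    · filter_upwards [ae_restrict_mem measurableSet_Ioi] with y hy
      rw [Real.norm_of_nonneg (by positivity)]
      exact hle y hy
  obtain ⟨h3, h4⟩ := integral_norm_sq_mellin_div (p := fun u => u) hh measurable_id hμ hσ0 hi h2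
  have hneg : ∀ (u : ℝ) (s : ℂ), -(g u * Real.log u * (u : ℂ) ^ (-s)) = h u * (u : ℂ) ^ (-s) :=
    fun u s => (neg_mul _ _).symm
  simp_rw [hneg]
  refine ⟨h3, ?_⟩
  rw [h4]
  calc _ ≤ 2 * Real.pi * ∫ y in Ioi (0 : ℝ), K ^ 2 * Real.exp (-(2 * (σ - 1)) * y) :=
        mul_le_mul_of_nonneg_left (setIntegral_mono_on h2 hmaj measurableSet_Ioi hle)
          (by positivity)
    _ = _ := by
        rw [integral_const_mul, integral_exp_mul_Ioi (by linarith), mul_zero, Real.exp_zero,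
          neg_div_neg_eq]
        field_simp [hσ1.ne']

end MeanSquare

/-! ### Application to Beurling systems. -/

namespace BeurlingSystem

variable (S : BeurlingSystem)

instance : IsLocallyFiniteMeasure S.dPi := by
  unfold dPi; infer_instance

theorem dPi_ae_one_le : ∀ᵐ u ∂S.dPi, 1 ≤ u := by
  have hlim : Filter.Tendsto S.primeCount Filter.atBot (nhds 0) := by
    refine tendsto_const_nhds.congr' ?_
    filter_upwards [Filter.eventually_lt_atBot 1] with x hx
    exact (S.primeCount_of_lt_one x hx).symm
  have h : S.dPi (Iic 1) = 0 := by
    rw [dPi, StieltjesFunction.measure_Iic _ hlim, S.primeCount_one]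
    simp
  rw [ae_iff]
  refine measure_mono_null (fun u hu => ?_) h
  exact (not_le.1 hu).le

theorem aestronglyMeasurable_of_integrableOn {g : ℝ → ℂ}
    (hloc : ∀ X : ℝ, IntegrableOn g (Icc 1 X) S.dPi) : AEStronglyMeasurable g S.dPi := by
  have h : AEStronglyMeasurable g (S.dPi.restrict (⋃ n : ℕ, Icc 1 (n : ℝ))) :=
    aestronglyMeasurable_iUnion_iff.2 fun n => (hloc n).1
  have hU : (⋃ n : ℕ, Icc 1 (n : ℝ)) =ᵐ[S.dPi] univ := by
    filter_upwards [S.dPi_ae_one_le] with u hu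
    obtain ⟨n, hn⟩ := exists_nat_ge u
    exact propext ⟨fun _ => trivial, fun _ => mem_iUnion.2 ⟨n, hu, hn⟩⟩
  rwa [Measure.restrict_congr_set hU, Measure.restrict_univ] at h

/-- This permits replacing g, which is only almost everywhere measurable, by a measurable
representative. -/
theorem dG_congr {g g' : ℝ → ℂ} (h : g =ᵐ[S.dPi] g') : S.dG g = S.dG g' := by
  ext1 X
  unfold dG convExpDensity
  rw [WithDensityᵥEq.congr_ae]
  refine ae_restrict_of_ae ?_
  filter_upwards [ae_tupleMeasure h] with c hc
  exact Finset.prod_congr rfl fun i _ => hc i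

variable {g : ℝ → ℂ} {K : ℝ} (hg : Measurable g) (hK0 : 0 ≤ K)
  (hloc : ∀ X : ℝ, IntegrableOn g (Icc 1 X) S.dPi)
  (hK : ∀ x : ℝ, 1 ≤ x → ∫⁻ u in {u | u ≤ x}, ‖g u‖ₑ * ENNReal.ofReal (Real.log u) ∂S.dPi ≤
    ENNReal.ofReal (K * x))

include hg hK0 hloc hK

theorem tendsto_mellinTrunc {s : ℂ} (hs : 1 < s.re) :
    Filter.Tendsto (S.mellinTrunc g s) Filter.atTop
      (nhds (Complex.exp (∫ u, g u * (u : ℂ) ^ (-s) ∂S.dPi))) :=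
  tendsto_convExpDensity_integral_cpow S.dPi_ae_one_le hg hloc (by linarith)
    (integrable_norm_mul_rpow S.dPi_ae_one_le hg hK0 hK hloc hs)

theorem mellinHat_eq {s : ℂ} (hs : 1 < s.re) :
    S.mellinHat g s = Complex.exp (∫ u, g u * (u : ℂ) ^ (-s) ∂S.dPi) :=
  (S.tendsto_mellinTrunc hg hK0 hloc hK hs).limUnder_eq

theorem hasDerivAt_mellinHat {s : ℂ} (hs : 1 < s.re) :
    HasDerivAt (S.mellinHat g)
      (S.mellinHat g s * ∫ u, -(g u * Real.log u * (u : ℂ) ^ (-s)) ∂S.dPi) s := by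
  have hopen : IsOpen {z : ℂ | 1 < z.re} := isOpen_lt continuous_const Complex.continuous_re
  rw [S.mellinHat_eq hg hK0 hloc hK hs]
  refine (hasDerivAt_integral_mul_cpow S.dPi_ae_one_le hg hK0 hK hloc hs).cexp.congr_of_eventuallyEq
    ?_
  filter_upwards [hopen.mem_nhds hs] with z hz
  exact S.mellinHat_eq hg hK0 hloc hK hz

end BeurlingSystem

theorem corollary3p2 (K : ℝ) :
    ∃ C : ℝ, ∀ (S : BeurlingSystem) (g : ℝ → ℂ),
      (∀ X : ℝ, IntegrableOn g (Set.Icc 1 X) S.dPi) →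
      (∀ x : ℝ, 2 ≤ x → ∫ u in Set.Icc 1 x, u⁻¹ ∂S.dPi ≤ Real.log (Real.log x) + K) →
      (∀ x : ℝ, 1 ≤ x → ∫ u in Set.Icc 1 x, ‖g u‖ * Real.log u ∂S.dPi ≤ K * x) →
      -- the bound for the summatory function
      (∀ x : ℝ, 1 ≤ x →
        ‖S.summatory g x‖ / x ≤ C * Real.exp (∫ u in Set.Icc 1 x, (‖g u‖ - 1) / u ∂S.dPi)) ∧
      -- the transform converges, is differentiable and has no zeros on the open half-plane
      (∀ s : ℂ, 1 < s.re →
        Filter.Tendsto (S.mellinTrunc g s) Filter.atTop (nhds (S.mellinHat g s)) ∧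
        DifferentiableAt ℂ (S.mellinHat g) s ∧ S.mellinHat g s ≠ 0) ∧
      -- the first mean-square bound on vertical lines
      (∀ σ : ℝ, 1 < σ →
        Integrable (fun t : ℝ => ‖S.mellinHat g (σ + t * Complex.I) / (σ + t * Complex.I)‖ ^ 2) ∧
        IntegrableOn (fun y : ℝ => Real.exp (-2 * y * (σ - 1)) *
          Real.exp (2 * ∫ u in Set.Icc 1 (Real.exp y), (‖g u‖ - 1) / u ∂S.dPi)) (Set.Ioi 0) ∧
        ∫ t : ℝ, ‖S.mellinHat g (σ + t * Complex.I) / (σ + t * Complex.I)‖ ^ 2 ≤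
          C * ∫ y in Set.Ioi (0 : ℝ), Real.exp (-2 * y * (σ - 1)) *
            Real.exp (2 * ∫ u in Set.Icc 1 (Real.exp y), (‖g u‖ - 1) / u ∂S.dPi)) ∧
      -- the second mean-square bound on vertical lines
      (∀ σ : ℝ, 1 < σ →
        Integrable (fun t : ℝ => ‖deriv (S.mellinHat g) (σ + t * Complex.I) /
          ((σ + t * Complex.I) * S.mellinHat g (σ + t * Complex.I))‖ ^ 2) ∧
        ∫ t : ℝ, ‖deriv (S.mellinHat g) (σ + t * Complex.I) /
          ((σ + t * Complex.I) * S.mellinHat g (σ + t * Complex.I))‖ ^ 2 ≤ C / (σ - 1)) := by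

  -- The sum of the constants of the three bounds, each non-negative since the second hypothesis at
  -- x = 1 forces K ≥ 0.
  refine ⟨(K + 1) * Real.exp K + 2 * Real.pi * ((K + 1) * Real.exp K) ^ 2 + Real.pi * K ^ 2,
    fun S g₀ hloc₀ hM hK₀ => ?_⟩
  obtain ⟨g, hgm, hgg⟩ := S.aestronglyMeasurable_of_integrableOn hloc₀
  have hg : Measurable g := hgm.measurable
  have hloc : ∀ X : ℝ, IntegrableOn g (Icc 1 X) S.dPi := fun X =>
    (hloc₀ X).congr (ae_restrict_of_ae hgg)
  have hdG := S.dG_congr hgg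
  have hsum : S.summatory g₀ = S.summatory g := by
    ext x; simp only [BeurlingSystem.summatory, hdG]
  have htrunc : S.mellinTrunc g₀ = S.mellinTrunc g := by
    ext s X; simp only [BeurlingSystem.mellinTrunc, hdG]
  have hhat : S.mellinHat g₀ = S.mellinHat g := by
    ext s; simp only [BeurlingSystem.mellinHat, htrunc]
  have hint : ∀ x : ℝ, ∫ u in Icc 1 x, (‖g₀ u‖ - 1) / u ∂S.dPi =
      ∫ u in Icc 1 x, (‖g u‖ - 1) / u ∂S.dPi := fun x =>
    integral_congr_ae ((ae_restrict_of_ae hgg).mono fun u hu => by simp only [hu])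
  have hK1 : ∀ x : ℝ, 1 ≤ x → ∫ u in Icc 1 x, ‖g u‖ * Real.log u ∂S.dPi ≤ K * x := fun x hx =>
    (integral_congr_ae ((ae_restrict_of_ae hgg).mono fun u hu => by simp only [hu])).symm.trans_le
      (hK₀ x hx)
  simp_rw [hsum, htrunc, hhat, hint]
  have hμ := S.dPi_ae_one_le
  have hK0 : 0 ≤ K := by
    have h0 : 0 ≤ ∫ u in Icc 1 1, ‖g u‖ * Real.log u ∂S.dPi :=
      setIntegral_nonneg measurableSet_Icc fun u hu =>
        mul_nonneg (norm_nonneg _) (Real.log_nonneg hu.1)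
    linarith [hK1 1 le_rfl]
  have hK : ∀ x : ℝ, 1 ≤ x → ∫⁻ u in {u | u ≤ x}, ‖g u‖ₑ * ENNReal.ofReal (Real.log u) ∂S.dPi ≤
      ENNReal.ofReal (K * x) := fun x hx =>
    setLIntegral_norm_mul_log_le hμ hg (hloc x) (hK1 x hx)
  have hC1 : 0 ≤ (K + 1) * Real.exp K := by positivity
  have hC2 : 0 ≤ 2 * Real.pi * ((K + 1) * Real.exp K) ^ 2 := by positivity
  have hC3 : 0 ≤ Real.pi * K ^ 2 := by positivity
  have hre : ∀ σ t : ℝ, 1 < σ → 1 < ((σ : ℂ) + t * Complex.I).re := fun σ t h => by simpa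
  refine ⟨fun x hx => ?_, fun s hs => ?_, fun σ hσ => ?_, fun σ hσ => ?_⟩
  · have h := norm_setIntegral_prod_div_le hμ hg hK0 hloc hM hK hx
    rw [← convExpDensity_Icc hμ hg (hloc x)] at h
    refine h.trans ?_
    gcongr
    linarith
  · refine ⟨?_, (S.hasDerivAt_mellinHat hg hK0 hloc hK hs).differentiableAt, ?_⟩
    · rw [S.mellinHat_eq hg hK0 hloc hK hs]
      exact S.tendsto_mellinTrunc hg hK0 hloc hK hs
    · rw [S.mellinHat_eq hg hK0 hloc hK hs]
      exact Complex.exp_ne_zero _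
  · obtain ⟨h1, h2⟩ := integral_norm_sq_exp_div_le hμ hg hK0 hloc hM hK hσ
    simp_rw [← fun t : ℝ => S.mellinHat_eq hg hK0 hloc hK (hre σ t hσ)] at h1 h2
    refine ⟨h1, integrableOn_exp_mul_exp_setIntegral hμ hg hK0 hK hloc (by linarith), h2.trans ?_⟩
    refine mul_le_mul_of_nonneg_right (by linarith) (integral_nonneg fun y => by positivity)
  · have hd : ∀ t : ℝ, deriv (S.mellinHat g) (σ + t * Complex.I) /
        ((σ + t * Complex.I) * S.mellinHat g (σ + t * Complex.I)) =
        (∫ u, -(g u * Real.log u * (u : ℂ) ^ (-(σ + t * Complex.I))) ∂S.dPi) /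
          (σ + t * Complex.I) := fun t => by
      have hne : S.mellinHat g (σ + t * Complex.I) ≠ 0 := by
        rw [S.mellinHat_eq hg hK0 hloc hK (hre σ t hσ)]
        exact Complex.exp_ne_zero _
      rw [(S.hasDerivAt_mellinHat hg hK0 hloc hK (hre σ t hσ)).deriv, mul_comm (S.mellinHat g _),
        mul_div_mul_right _ _ hne]
    obtain ⟨h1, h2⟩ := integral_norm_sq_integral_log_div_le hμ hg hK0 hK hσ
    simp_rw [hd]
    refine ⟨h1, h2.trans ?_⟩
    have : 0 < σ - 1 := by linarith
    gcongr
    linarith
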